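/- Let $k$ be an algebraically closed field of characteristic $0$, let $g,\ell$ be integers with $1\le \ell\le g-2$, and let $C_\ell$ be the ribbon of genus $g$ obtained by gluing $U_1=\operatorname{Spec} k[x,\varepsilon]/(\varepsilon^2)$ and $U_2=\operatorname{Spec} k[y,\eta]/(\eta^2)$ along $\{x\ne 0\}$ and $\{y\neq 0\}$ by $$x\mapsto y^{-1}-y^{-\ell-2}\eta,\qquad \varepsilon\mapsto y^{-g-1}\eta .$$ Let $\omega$ be its dualizing sheaf, generated by $\frac{dx\wedge d\varepsilon}{\varepsilon^2}$ on $U_1$ and by $\frac{dy\wedge d\eta}{\eta^2}$ on $U_2$. Put $N=g$ if $n=1$ and $N=(2n-1)(g-1)$ if $n\ge 2$. For $n\ge 1$ the space $H^0(C_\ell,\omega^n)$ has dimension $N$. For $m\ge 2$ the $m$-th Hilbert point of the $n$-canonical embedding of $C_\ell$ is the point of $\mathbb P\bigl(\bigwedge^{P}(\operatorname{Sym}^m H^0(C_\ell,\omega^n))^\vee\bigr)$, $P=h^0(C_\ell,\omega^{nm})$, given by the $P$-th exterior power of the multiplication map $\operatorname{Sym}^m H^0(C_\ell,\omega^n)\to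 H^0(C_\ell,\omega^{nm})$; (in)stability refers to the action of $\operatorname{SL}(H^0(C_\ell,\omega^n))\cong \operatorname{SL}_N$. Theorem (Hilbert stability of ribbons). The formula $t\cdot(x,y,\varepsilon,\eta)=(tx,\,t^{-1}y,\,t^{g-\ell}\varepsilon,\,t^{-\ell-1}\eta)$ defines an action $\rho$ of $\mathbb G_m$ on $C_\ell$ over $k$, and: 1. If $\ell\ne (g-1)/2$, then the $m$-th Hilbert point of the $n$-canonical embedding of $C_\ell$ is well defined (the exterior power is non-zero) and unstable for all $m\ge 2$ and $n\ge 1$. 2. If $\ell=(g-1)/2$, then the $m$-th Hilbert point of the $n$-canonical embedding of $C_\ell$ is well defined and unstable for all $m\ge 2$ and $n\ge 2$ with $(g,n,m)\neq (3,2,2)$. 3. If $\ell=(g-1)/2$, then the action induced by $\rho$ on $H^0(C_\ell,\omega)$ is a one-parameter subgroup of $\operatorname{SL}(H^0(C_\ell,\omega))$, and for all $m\ge 2$ the $m$-th Hilbert point of the canonical embedding of $C_\ell$ is strictly semistable with respect to $\rho$, i.e. its Hilbert–Mumford indices with respect to this subgroup and its inverse are $0$. -/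

import Mathlib

open CategoryTheory AlgebraicGeometry MonoidalCategory
open scoped LaurentPolynomial DualNumber

universe u

noncomputable section

namespace Ribbon

variable (k : Type u) [Field k]

/-! ### The two charts and the gluing isomorphism -/

/-- The coordinate ring `k[z, ε]/(ε²)` of a chart; used with `z = x` and with `z = y` (then `ε` is
written `η` in comments). -/
abbrev Chart : Type u := DualNumber (Polynomial k)

/-- The coordinate ring `k[y, y⁻¹, η]/(η²)` of the overlap, in the coordinates of the second
chart. -/
abbrev Overlap : Type u := DualNumber k[T;T⁻¹]

variable {k}

/-- The restriction `k[y, η]/(η²) → k[y, y⁻¹, η]/(η²)`. -/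
def restrict : Chart k →ₐ[k] Overlap k :=
  DualNumber.lift ⟨((TrivSqZeroExt.inlAlgHom k k[T;T⁻¹] k[T;T⁻¹]).comp Polynomial.toLaurentAlg,
    DualNumber.eps), by simp, fun _ => Commute.all _ _⟩

/-- The unit `y⁻¹ - y⁻² f(y) η` of the overlap, with inverse `y + f(y) η`. -/
def xUnit (f : k[T;T⁻¹]) : (Overlap k)ˣ where
  val := TrivSqZeroExt.inl (LaurentPolynomial.T (-1)) -
    TrivSqZeroExt.inr (LaurentPolynomial.T (-2) * f)
  inv := TrivSqZeroExt.inl (LaurentPolynomial.T 1) + TrivSqZeroExt.inr f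
  val_inv := by
    ext1
    · simp only [TrivSqZeroExt.fst_mul, TrivSqZeroExt.fst_sub, TrivSqZeroExt.fst_inl,
        TrivSqZeroExt.fst_inr, TrivSqZeroExt.fst_add, TrivSqZeroExt.fst_one, sub_zero, add_zero,
        ← LaurentPolynomial.T_add]
      simp
    · simp only [TrivSqZeroExt.snd_mul, TrivSqZeroExt.fst_sub, TrivSqZeroExt.fst_inl,
        TrivSqZeroExt.fst_inr, TrivSqZeroExt.snd_add, TrivSqZeroExt.snd_inl,
        TrivSqZeroExt.snd_inr, TrivSqZeroExt.snd_sub, TrivSqZeroExt.fst_add,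
        TrivSqZeroExt.snd_one, smul_eq_mul, MulOpposite.smul_eq_mul_unop, MulOpposite.unop_op]
      have h : (LaurentPolynomial.T (-1) : k[T;T⁻¹]) =
          LaurentPolynomial.T (-2) * LaurentPolynomial.T 1 := by
        rw [← LaurentPolynomial.T_add]; norm_num
      rw [h]; ring
  inv_val := by
    ext1
    · simp only [TrivSqZeroExt.fst_mul, TrivSqZeroExt.fst_sub, TrivSqZeroExt.fst_inl,
        TrivSqZeroExt.fst_inr, TrivSqZeroExt.fst_add, TrivSqZeroExt.fst_one, sub_zero, add_zero,
        ← LaurentPolynomial.T_add]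
      simp
    · simp only [TrivSqZeroExt.snd_mul, TrivSqZeroExt.fst_sub, TrivSqZeroExt.fst_inl,
        TrivSqZeroExt.fst_inr, TrivSqZeroExt.snd_add, TrivSqZeroExt.snd_inl,
        TrivSqZeroExt.snd_inr, TrivSqZeroExt.snd_sub, TrivSqZeroExt.fst_add,
        TrivSqZeroExt.snd_one, smul_eq_mul, MulOpposite.smul_eq_mul_unop, MulOpposite.unop_op]
      have h : (LaurentPolynomial.T (-1) : k[T;T⁻¹]) =
          LaurentPolynomial.T (-2) * LaurentPolynomial.T 1 := by
        rw [← LaurentPolynomial.T_add]; norm_num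
      rw [h]; ring

/-- The gluing isomorphism `φ : k[x, x⁻¹, ε]/(ε²) → k[y, y⁻¹, η]/(η²)` of a ribbon of genus `g`,
`x ↦ y⁻¹ - y⁻² f(y) η`, `ε ↦ y^(-g-1) η`. -/
def glue (g : ℕ) (f : k[T;T⁻¹]) : Overlap k →ₐ[k] Overlap k :=
  DualNumber.lift ⟨(AddMonoidAlgebra.lift k (Overlap k) ℤ
      ((Units.coeHom (Overlap k)).comp (zpowersHom (Overlap k)ˣ (xUnit f))),
    TrivSqZeroExt.inr (LaurentPolynomial.T (-(g : ℤ) - 1))), by simp, fun _ => Commute.all _ _⟩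

theorem fst_xUnit_zpow (f : k[T;T⁻¹]) (n : ℤ) :
    (((xUnit f) ^ n : (Overlap k)ˣ) : Overlap k).fst = LaurentPolynomial.T (-n) := by
  have key : ∀ m : ℕ, ((xUnit f : Overlap k) ^ m).fst = LaurentPolynomial.T (-(m : ℤ)) ∧
      (((xUnit f)⁻¹ : (Overlap k)ˣ) ^ m : Overlap k).fst = LaurentPolynomial.T (m : ℤ) := by
    intro m
    have h1 : (xUnit f : Overlap k).fst = LaurentPolynomial.T (-1) := by simp [xUnit]
    have h2 : (((xUnit f)⁻¹ : (Overlap k)ˣ) : Overlap k).fst = LaurentPolynomial.T 1 := by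
      simp [xUnit, Units.inv_mk]
    rw [TrivSqZeroExt.fst_pow, TrivSqZeroExt.fst_pow, h1, h2, LaurentPolynomial.T_pow,
      LaurentPolynomial.T_pow]
    constructor <;> congr 1 <;> ring
  obtain ⟨m, rfl | rfl⟩ := n.eq_nat_or_neg
  · rw [zpow_natCast, Units.val_pow_eq_pow_val]
    exact (key m).1
  · rw [zpow_neg, zpow_natCast, ← inv_pow, Units.val_pow_eq_pow_val, neg_neg]
    exact (key m).2

theorem fst_glue (g : ℕ) (f : k[T;T⁻¹]) (z : Overlap k) :
    (glue g f z).fst = LaurentPolynomial.invert z.fst := by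
  have h : ((TrivSqZeroExt.fstHom k k[T;T⁻¹] k[T;T⁻¹]).comp (AddMonoidAlgebra.lift k (Overlap k) ℤ
      ((Units.coeHom (Overlap k)).comp (zpowersHom (Overlap k)ˣ (xUnit f))))) =
      (LaurentPolynomial.invert : k[T;T⁻¹] ≃ₐ[k] k[T;T⁻¹]).toAlgHom := by
    refine AddMonoidAlgebra.algHom_ext (fun n => ?_) (Subsingleton.elim _ _)
    have := fst_xUnit_zpow f n
    have h2 : (LaurentPolynomial.invert (LaurentPolynomial.T n) : k[T;T⁻¹])
      = LaurentPolynomial.T (-n) := by simp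
    have h3 := this.trans h2.symm
    rw [LaurentPolynomial.T] at h3
    rw [AlgHom.comp_apply, AddMonoidAlgebra.lift_single, one_smul]
    exact h3
  have h3 := DFunLike.congr_fun h z.fst
  rw [glue, DualNumber.lift_apply_apply]
  simpa using h3

theorem glue_inr (g : ℕ) (f q : k[T;T⁻¹]) :
    glue g f (TrivSqZeroExt.inr q) =
      TrivSqZeroExt.inr (LaurentPolynomial.invert q * LaurentPolynomial.T (-(g : ℤ) - 1)) := by
  have h := fst_glue g f (TrivSqZeroExt.inl q)
  rw [glue, DualNumber.lift_apply_apply] at h ⊢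
  ext1
  · simp
  · simp at h
    simp [h]

theorem glue_bijective (g : ℕ) (f : k[T;T⁻¹]) : Function.Bijective (glue g f) := by
  constructor
  · rw [injective_iff_map_eq_zero]
    intro z hz
    have h1 : z.fst = 0 := by
      have := fst_glue g f z
      rw [hz] at this
      simpa using this.symm
    have h2 : z = TrivSqZeroExt.inr z.snd := by ext1 <;> simp [h1]
    rw [h2, glue_inr] at hz
    have h3 := congrArg TrivSqZeroExt.snd hz
    simp only [TrivSqZeroExt.snd_inr, TrivSqZeroExt.snd_zero] at h3
    have h4 := (LaurentPolynomial.isUnit_T (R := k) (-(g : ℤ) - 1)).mul_left_eq_zero.mp h3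
    have h5 : z.snd = 0 := by simpa using h4
    rw [h2, h5, TrivSqZeroExt.inr_zero]
  · intro w
    let p : k[T;T⁻¹] := LaurentPolynomial.invert w.fst
    let c := (glue g f (TrivSqZeroExt.inl p)).snd
    let q : k[T;T⁻¹] := LaurentPolynomial.invert ((w.snd - c) * LaurentPolynomial.T ((g : ℤ) + 1))
    refine ⟨TrivSqZeroExt.inl p + TrivSqZeroExt.inr q, ?_⟩
    rw [map_add, glue_inr]
    ext1
    · rw [TrivSqZeroExt.fst_add, fst_glue]
      simp [p, LaurentPolynomial.involutive_invert w.fst]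
    · have h : LaurentPolynomial.T ((g : ℤ) + 1) * LaurentPolynomial.T (-(g : ℤ) - 1) =
          (1 : k[T;T⁻¹]) := by
        rw [← LaurentPolynomial.T_add, ← LaurentPolynomial.T_zero]; congr 1; ring
      have h' : (LaurentPolynomial.invert q : k[T;T⁻¹]) =
          (w.snd - c) * LaurentPolynomial.T ((g : ℤ) + 1) :=
        LaurentPolynomial.invert.symm_apply_apply _
      rw [TrivSqZeroExt.snd_add, TrivSqZeroExt.snd_inr, h', mul_assoc, h]
      simp [c]

theorem restrict_eq (z : Chart k) : restrict z =
    TrivSqZeroExt.inl (Polynomial.toLaurent z.fst) +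
      TrivSqZeroExt.inr (Polynomial.toLaurent z.snd) := by
  rw [restrict, DualNumber.lift_apply_apply]
  ext1 <;> simp

theorem isLocalization_restrict : @IsLocalization.Away (Chart k) _
    (TrivSqZeroExt.inl Polynomial.X) (Overlap k) _ (restrict (k := k)).toRingHom.toAlgebra := by
  let := (restrict (k := k)).toRingHom.toAlgebra
  have hX : ∀ n : ℕ, algebraMap (Chart k) (Overlap k) ((TrivSqZeroExt.inl Polynomial.X) ^ n) =
      TrivSqZeroExt.inl (LaurentPolynomial.T n) := by
    intro n
    change restrict _ = _
    have h : (TrivSqZeroExt.inl Polynomial.X : Chart k) ^ n =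
        TrivSqZeroExt.inl (Polynomial.X ^ n) :=
      (map_pow (TrivSqZeroExt.inlHom (Polynomial k) (Polynomial k)) Polynomial.X n).symm
    rw [h, restrict_eq]
    simp
  have hinj : Function.Injective (algebraMap (Chart k) (Overlap k)) := by
    intro z w h
    change restrict z = restrict w at h
    rw [restrict_eq, restrict_eq] at h
    have h1 := congrArg TrivSqZeroExt.fst h
    have h2 := congrArg TrivSqZeroExt.snd h
    simp only [TrivSqZeroExt.fst_add, TrivSqZeroExt.fst_inl, TrivSqZeroExt.fst_inr, add_zero,
      TrivSqZeroExt.snd_add, TrivSqZeroExt.snd_inl, TrivSqZeroExt.snd_inr, zero_add] at h1 h2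
    ext1
    · exact Polynomial.toLaurent_injective h1
    · exact Polynomial.toLaurent_injective h2
  refine ⟨?_, ?_, ?_⟩
  · rintro ⟨_, n, rfl⟩
    simp only [hX]
    exact (LaurentPolynomial.isUnit_T (R := k) n).map (TrivSqZeroExt.inlHom k[T;T⁻¹] k[T;T⁻¹])
  · intro z
    obtain ⟨a, p, hp⟩ := LaurentPolynomial.exists_T_pow z.fst
    obtain ⟨b, q, hq⟩ := LaurentPolynomial.exists_T_pow z.snd
    refine ⟨(TrivSqZeroExt.inl (p * Polynomial.X ^ b) + TrivSqZeroExt.inr (q * Polynomial.X ^ a),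
      ⟨_, a + b, rfl⟩), ?_⟩
    simp only [hX]
    change _ = restrict _
    rw [restrict_eq]
    have e1 : (LaurentPolynomial.T ((a + b : ℕ) : ℤ) : k[T;T⁻¹]) =
        LaurentPolynomial.T a * LaurentPolynomial.T b := by
      rw [← LaurentPolynomial.T_add]; push_cast; rfl
    ext1
    · simp only [e1, TrivSqZeroExt.fst_mul, TrivSqZeroExt.fst_inl, TrivSqZeroExt.fst_add,
        TrivSqZeroExt.fst_inr, map_mul, hp, Polynomial.toLaurent_X_pow, add_zero]
      ring
    · simp only [e1, TrivSqZeroExt.snd_mul, TrivSqZeroExt.fst_inl, TrivSqZeroExt.snd_inl,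
        smul_eq_mul, MulOpposite.smul_eq_mul_unop, MulOpposite.unop_op, TrivSqZeroExt.snd_add,
        TrivSqZeroExt.fst_add, TrivSqZeroExt.fst_inr, TrivSqZeroExt.snd_inr, map_mul, hq,
        Polynomial.toLaurent_X_pow, mul_zero, zero_add, add_zero]
      ring
  · intro z w h
    exact ⟨1, by rw [hinj h]⟩

/-! ### The ribbon as a scheme over `k` -/

/-- The open immersion of the overlap into the first chart. -/
def overlapToFst (g : ℕ) (f : k[T;T⁻¹]) : Spec (.of (Overlap k)) ⟶ Spec (.of (Chart k)) :=
  Spec.map (CommRingCat.ofHom ((glue g f).comp restrict).toRingHom)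

variable (k) in
/-- The open immersion of the overlap into the second chart. -/
def overlapToSnd : Spec (.of (Overlap k)) ⟶ Spec (.of (Chart k)) :=
  Spec.map (CommRingCat.ofHom (restrict (k := k)).toRingHom)

instance : IsOpenImmersion (overlapToSnd k) := by
  let := (restrict (k := k)).toRingHom.toAlgebra
  have := isLocalization_restrict (k := k)
  exact IsOpenImmersion.of_isLocalization (R := Chart k) (S := Overlap k)
    (TrivSqZeroExt.inl Polynomial.X : Chart k)

instance (g : ℕ) (f : k[T;T⁻¹]) : IsOpenImmersion (overlapToFst g f) := by
  have h : overlapToFst g f =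
      Spec.map (CommRingCat.ofHom (glue g f).toRingHom) ≫ overlapToSnd k := by
    rw [overlapToSnd, ← Spec.map_comp]; rfl
  have : IsIso (CommRingCat.ofHom (glue g f).toRingHom) :=
    (ConcreteCategory.isIso_iff_bijective _).mpr (glue_bijective g f)
  rw [h]
  infer_instance

instance (g : ℕ) (f : k[T;T⁻¹]) : Limits.HasPushout (overlapToFst g f) (overlapToSnd k) := by
  have : ∀ {i j} (q : i ⟶ j),
      IsOpenImmersion ((Limits.span (overlapToFst g f) (overlapToSnd k)).map q) := by
    rintro _ _ (_ | (_ | _))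
    · simp only [Limits.WidePushoutShape.hom_id, CategoryTheory.Functor.map_id]; infer_instance
    · change IsOpenImmersion (overlapToFst g f); infer_instance
    · change IsOpenImmersion (overlapToSnd k); infer_instance
  infer_instance

/-- The scheme obtained by gluing the two charts along the overlap by means of `φ`. -/
def scheme (g : ℕ) (f : k[T;T⁻¹]) : Scheme.{u} :=
  Limits.pushout (overlapToFst g f) (overlapToSnd k)

/-- The inclusion of the first chart `U₁ = Spec k[x, ε]/(ε²)`. -/
def fstChart (g : ℕ) (f : k[T;T⁻¹]) : Spec (.of (Chart k)) ⟶ scheme g f :=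
  Limits.pushout.inl _ _

/-- The inclusion of the second chart `U₂ = Spec k[y, η]/(η²)`. -/
def sndChart (g : ℕ) (f : k[T;T⁻¹]) : Spec (.of (Chart k)) ⟶ scheme g f :=
  Limits.pushout.inr _ _

/-- The ribbon as a scheme over `k`. -/
def overScheme (g : ℕ) (f : k[T;T⁻¹]) : Over (Spec (.of k)) :=
  Over.mk (Y := scheme g f) (Limits.pushout.desc
    (Spec.map (CommRingCat.ofHom (algebraMap k (Chart k))))
    (Spec.map (CommRingCat.ofHom (algebraMap k (Chart k)))) (by
      simp only [overlapToFst, overlapToSnd, ← Spec.map_comp, ← CommRingCat.ofHom_comp]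
      congr 2
      exact ((glue g f).comp restrict).comp_algebraMap.trans (restrict (k := k)).comp_algebraMap.symm))

/-! ### Pluricanonical sections

The dualizing sheaf is described by adjunction: over `U₁` it is generated by the restriction of
`dx ∧ dε / ε²` from `Spec k[x, ε]`, over `U₂` by the restriction of `dy ∧ dη / η²` from
`Spec k[y, η]`. -/

/-- The derivative `d/dy` of Laurent polynomials. -/
def deriv (p : k[T;T⁻¹]) : k[T;T⁻¹] :=
  p.coeff.sum fun i c => LaurentPolynomial.C ((i : k) * c) * LaurentPolynomial.T (i - 1)

/-- The Jacobian factor of a change of coordinates `x = a₀ + a₁ η`, `ε = u η`: with `v = u⁻¹`,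
`dx ∧ dε / ε² = (x_y ε_η - x_η ε_y) η² / ε² · dy ∧ dη / η²
  = ((a₀' + a₁' η) u - a₁ u' η) v² · dy ∧ dη / η²`. -/
def jacobian (a₀ a₁ u v : k[T;T⁻¹]) : Overlap k :=
  TrivSqZeroExt.inl (deriv a₀ * u * v ^ 2) +
    TrivSqZeroExt.inr ((deriv a₁ * u - a₁ * deriv u) * v ^ 2)

/-- The transition function of the dualizing sheaf:
`dx ∧ dε / ε² = transition g f · dy ∧ dη / η²` for `x = y⁻¹ - y⁻² f(y) η`, `ε = y^(-g-1) η`. -/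
def transition (g : ℕ) (f : k[T;T⁻¹]) : Overlap k :=
  jacobian (LaurentPolynomial.T (-1)) (-(LaurentPolynomial.T (-2) * f))
    (LaurentPolynomial.T (-(g : ℤ) - 1)) (LaurentPolynomial.T ((g : ℤ) + 1))

/-- `H⁰(C, ω^n)`: pairs `(s₁, s₂)` such that `s₁ (dx ∧ dε / ε²)^n` on `U₁` and
`s₂ (dy ∧ dη / η²)^n` on `U₂` agree on the overlap. -/
def sections (g : ℕ) (f : k[T;T⁻¹]) (n : ℕ) : Submodule k (Chart k × Chart k) where
  carrier := {s | glue g f (restrict s.1) * transition g f ^ n = restrict s.2}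
  add_mem' {s t} hs ht := by
    simp only [Set.mem_ofPred_eq, Prod.fst_add, Prod.snd_add, map_add, add_mul] at *
    rw [hs, ht]
  zero_mem' := by simp
  smul_mem' c s hs := by
    simp only [Set.mem_ofPred_eq, Prod.smul_fst, Prod.smul_snd, map_smul, smul_mul_assoc] at *
    rw [hs]

theorem mul_mem_sections {g : ℕ} {f : k[T;T⁻¹]} {a b : ℕ} {s t : Chart k × Chart k}
    (hs : s ∈ sections g f a) (ht : t ∈ sections g f b) : s * t ∈ sections g f (a + b) := by
  change glue g f (restrict s.1) * transition g f ^ a = restrict s.2 at hs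
  change glue g f (restrict t.1) * transition g f ^ b = restrict t.2 at ht
  change glue g f (restrict (s.1 * t.1)) * transition g f ^ (a + b) = restrict (s.2 * t.2)
  rw [map_mul, map_mul, map_mul, ← hs, ← ht, pow_add]
  ring

end Ribbon

/-! ### Symmetric powers, Hilbert points and stability -/

namespace GIT

variable {k : Type*} [Field k] {V : Type*} [AddCommGroup V] [Module k V]

variable (k V) in
/-- The symmetric power `Sym^m V`, as the degree `m` part of the symmetric algebra. -/
def symPow (m : ℕ) : Submodule k (SymmetricAlgebra k V) :=
  LinearMap.range (SymmetricAlgebra.ι k V) ^ m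

/-- The linear map `Sym^m V → A` induced by a linear map `V → A` to a commutative algebra. -/
def symPowLift {A : Type*} [CommSemiring A] [Algebra k A] (φ : V →ₗ[k] A) (m : ℕ) :
    symPow k V m →ₗ[k] A :=
  (SymmetricAlgebra.lift φ).toLinearMap.domRestrict (symPow k V m)

theorem symPowLift_mem {A : Type*} [CommSemiring A] [Algebra k A] (φ : V →ₗ[k] A) (m : ℕ)
    (z : symPow k V m) : symPowLift φ m z ∈ LinearMap.range φ ^ m := by
  have h : symPowLift φ m z ∈ (LinearMap.range (SymmetricAlgebra.ι k V) ^ m).map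
      (SymmetricAlgebra.lift φ).toLinearMap := ⟨z, z.2, rfl⟩
  have e : (SymmetricAlgebra.lift φ).toLinearMap ∘ₗ SymmetricAlgebra.ι k V = φ :=
    SymmetricAlgebra.lift_comp_ι φ
  rwa [Submodule.map_pow, ← LinearMap.range_comp, e] at h

/-- The functorial map `Sym^m V → Sym^m V` of an endomorphism of `V`. -/
def symPowMap (φ : V →ₗ[k] V) (m : ℕ) : symPow k V m →ₗ[k] symPow k V m :=
  (symPowLift (SymmetricAlgebra.ι k V ∘ₗ φ) m).codRestrict _ fun z =>
    pow_le_pow_left' (LinearMap.range_comp_le_range _ _) m (symPowLift_mem _ m z)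

theorem symPowMap_one (m : ℕ) : symPowMap (1 : V →ₗ[k] V) m = LinearMap.id := by
  ext z
  have : (SymmetricAlgebra.ι k V ∘ₗ (1 : V →ₗ[k] V)) = SymmetricAlgebra.ι k V := rfl
  simp [symPowMap, symPowLift, this]

theorem symPowMap_mul (φ ψ : V →ₗ[k] V) (m : ℕ) :
    symPowMap (φ * ψ) m = symPowMap φ m ∘ₗ symPowMap ψ m := by
  ext z
  have : SymmetricAlgebra.lift (SymmetricAlgebra.ι k V ∘ₗ (φ * ψ)) =
      (SymmetricAlgebra.lift (SymmetricAlgebra.ι k V ∘ₗ φ)).comp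
        (SymmetricAlgebra.lift (SymmetricAlgebra.ι k V ∘ₗ ψ)) := by
    apply SymmetricAlgebra.algHom_ext
    ext v
    simp
  simp [symPowMap, symPowLift, this]

variable (k V) in
/-- The representation of `SL(V)` on `⋀^P (Sym^m V)^∨`, realized as alternating forms in `P`
variables on `Sym^m V`: `(γ · x)(p₁, …, p_P) = x(γ⁻¹ p₁, …, γ⁻¹ p_P)`. -/
def hilbertRep (m P : ℕ) :
    Representation k (SpecialLinearGroup k V) (symPow k V m [⋀^Fin P]→ₗ[k] k) where
  toFun γ :=
    { toFun := fun x => x.compLinearMap (symPowMap (γ⁻¹ : SpecialLinearGroup k V).1.toLinearMap m)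
      map_add' := fun _ _ => rfl
      map_smul' := fun _ _ => rfl }
  map_one' := by
    ext1 x
    have h : ((1 : SpecialLinearGroup k V)⁻¹).1.toLinearMap = (1 : V →ₗ[k] V) := by
      rw [inv_one]; rfl
    change x.compLinearMap (symPowMap _ m) = x
    rw [h, symPowMap_one, AlternatingMap.compLinearMap_id]
  map_mul' γ δ := by
    ext1 x
    have h : ((γ * δ)⁻¹ : SpecialLinearGroup k V).1.toLinearMap =
        (δ⁻¹ : SpecialLinearGroup k V).1.toLinearMap *
          (γ⁻¹ : SpecialLinearGroup k V).1.toLinearMap := by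
      rw [mul_inv_rev]; rfl
    change x.compLinearMap (symPowMap _ m) =
      (x.compLinearMap (symPowMap _ m)).compLinearMap (symPowMap _ m)
    rw [h, symPowMap_mul, AlternatingMap.compLinearMap_assoc]

variable {G : Type*} [Group G] {W : Type*} [AddCommGroup W] [Module k W]

/-- The point of `ℙ(W)` represented by `x` is semistable: some `G`-invariant homogeneous polynomial
of positive degree on `W` does not vanish at `x`. A homogeneous polynomial of degree `d` is written
as `w ↦ F(w, …, w)` with `F` a `d`-linear form. -/
def IsSemistable (ρ : Representation k G W) (x : W) : Prop :=
  ∃ (d : ℕ) (F : MultilinearMap k (fun _ : Fin d => W) k), 0 < d ∧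
    (∀ (γ : G) (w : W), F (fun _ => ρ γ w) = F (fun _ => w)) ∧ F (fun _ => x) ≠ 0

/-- `x` represents a point of `ℙ(W)`, and this point is not semistable. -/
def IsUnstable (ρ : Representation k G W) (x : W) : Prop :=
  x ≠ 0 ∧ ¬ IsSemistable ρ x

/-- `μ` is the Hilbert–Mumford index of `x` with respect to the one-parameter subgroup `σ`:
`x` is a sum of weight vectors `c i`, on which `σ t` acts as `t^i`, and `μ` is the maximum of `-i`
over the weights `i` with `c i ≠ 0`. -/
def IsHilbertMumfordIndex (ρ : Representation k G W) (σ : kˣ →* G) (x : W) (μ : ℤ) : Prop :=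
  ∃ c : ℤ →₀ W, (∀ (i : ℤ) (t : kˣ), ρ (σ t) (c i) = ((t ^ i : kˣ) : k) • c i) ∧
    (c.sum fun _ w => w) = x ∧ IsGreatest {j : ℤ | c (-j) ≠ 0} μ

/-- `x` is strictly semistable with respect to `σ`: the Hilbert–Mumford indices with respect to
`σ` and to the inverse one-parameter subgroup both vanish, so that neither is negative
(semistability with respect to `σ(𝔾ₘ)`) and they are not both positive (no stability). -/
def IsStrictlySemistableWrt (ρ : Representation k G W) (σ : kˣ →* G) (x : W) : Prop :=
  IsHilbertMumfordIndex ρ σ x 0 ∧ IsHilbertMumfordIndex ρ (σ.comp invMonoidHom) x 0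

end GIT

namespace Ribbon

open GIT

variable {k : Type u} [Field k]

/-- The restriction `Sym^m H⁰(C, ω^n) → H⁰(C, ω^(nm))` of degree `m` hypersurfaces to the
`n`-canonical image of `C`. -/
def restrictSym (g : ℕ) (f : k[T;T⁻¹]) (n m : ℕ) :
    symPow k (sections g f n) m →ₗ[k] sections g f (n * m) :=
  (symPowLift (sections g f n).subtype m).codRestrict _ fun z => by
    have h : ∀ m : ℕ, sections g f n ^ m ≤ sections g f (n * m) := by
      intro m
      induction m with
      | zero =>
        rw [Submodule.pow_zero, Submodule.one_le]
        change glue g f (restrict 1) * transition g f ^ 0 = restrict 1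
        simp
      | succ m ih =>
        rw [Submodule.pow_succ, Submodule.mul_le]
        exact fun s hs t ht => mul_mem_sections (ih hs) ht
    have hz := symPowLift_mem (sections g f n).subtype m z
    rw [Submodule.range_subtype] at hz
    exact h m hz

/-- The `m`-th Hilbert point of the `n`-canonical embedding, in coordinates: the `P`-th exterior
power of `Sym^m H⁰(C, ω^n) → H⁰(C, ω^(nm))`, where `P = h⁰(C, ω^(nm))` and the line
`⋀^P H⁰(C, ω^(nm))` is trivialized by a basis `b` (another basis changes it by a scalar). -/
def hilbertPoint (g : ℕ) (f : k[T;T⁻¹]) (n m : ℕ)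
    (b : Module.Basis (Fin (Module.finrank k (sections g f (n * m)))) k (sections g f (n * m))) :
    symPow k (sections g f n) m [⋀^Fin (Module.finrank k (sections g f (n * m)))]→ₗ[k] k :=
  b.det.compLinearMap (restrictSym g f n m)

/-- The `m`-th Hilbert point of the `n`-canonical embedding is unstable under `SL(H⁰(C, ω^n))`. -/
def HilbertUnstable (g : ℕ) (f : k[T;T⁻¹]) (n m : ℕ) : Prop :=
  ∀ b, IsUnstable (hilbertRep k (sections g f n) m _) (hilbertPoint g f n m b)

/-! ### The action of the multiplicative group -/

variable (k) in
/-- The multiplicative group over `k`; its group structure is that of the Hopf algebra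
`k[T, T⁻¹]`. -/
abbrev Gm : Over (Spec (.of k)) := (Spec (.of k[T;T⁻¹])).asOver (Spec (.of k))

/-- The `k`-point `t` of the multiplicative group. -/
def Gm.point (t : kˣ) : 𝟙_ (Over (Spec (.of k))) ⟶ Gm k :=
  Over.homMk (Spec.map (CommRingCat.ofHom (LaurentPolynomial.eval₂ (RingHom.id k) t))) (by
    change Spec.map _ ≫ Spec.map _ = 𝟙 _
    rw [← Spec.map_comp, ← CommRingCat.ofHom_comp]
    have h : (LaurentPolynomial.eval₂ (RingHom.id k) t).comp (algebraMap k k[T;T⁻¹]) =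
        RingHom.id k := by
      ext c
      exact LaurentPolynomial.eval₂_C (RingHom.id k) t c
    rw [h]
    exact Spec.map_id _)

/-- The automorphism of `C` by which `t` acts. -/
def actBy {C : Over (Spec (.of k))} (ρ : ModObj (Gm k) C) (t : kˣ) : C ⟶ C :=
  (λ_ C).inv ≫ (Gm.point t ▷ C) ≫ ρ.smul

/-- The endomorphism `z ↦ a z`, `ε ↦ b ε` of `k[z, ε]/(ε²)`. -/
def scale (a b : kˣ) : Chart k →ₐ[k] Chart k :=
  DualNumber.lift ⟨((TrivSqZeroExt.inlAlgHom k (Polynomial k) (Polynomial k)).comp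
      (Polynomial.aeval (Polynomial.C (a : k) * Polynomial.X)),
    TrivSqZeroExt.inr (Polynomial.C (b : k))), by simp, fun _ => Commute.all _ _⟩

/-- The pullback of `h (dz ∧ dε / ε²)^n` under `z ↦ a z`, `ε ↦ b ε`, which multiplies
`dz ∧ dε / ε²` by `a b / b² = a / b`. -/
def scaleForm (n : ℕ) (a b : kˣ) (h : Chart k) : Chart k :=
  (((a / b) ^ n : kˣ) : k) • scale a b h

/-- The ribbon `C_ℓ` of genus `g` is given by `f(y) = y^(-ℓ)`. -/
abbrev monomialF (k : Type u) [Field k] (ℓ : ℕ) : k[T;T⁻¹] := LaurentPolynomial.T (-(ℓ : ℤ))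

/-- The action `t · (x, y, ε, η) = (t x, t⁻¹ y, t^(g-ℓ) ε, t^(-ℓ-1) η)` of the multiplicative group
on the ribbon `C_ℓ`. -/
def IsStandardAction (g ℓ : ℕ) (ρ : ModObj (Gm k) (overScheme g (monomialF k ℓ))) : Prop :=
  ∀ t : kˣ,
    fstChart g (monomialF k ℓ) ≫ (actBy ρ t).left =
      Spec.map (CommRingCat.ofHom (scale t (t ^ ((g : ℤ) - ℓ))).toRingHom) ≫
        fstChart g (monomialF k ℓ) ∧
    sndChart g (monomialF k ℓ) ≫ (actBy ρ t).left =
      Spec.map (CommRingCat.ofHom (scale t⁻¹ (t ^ (-(ℓ : ℤ) - 1))).toRingHom) ≫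
        sndChart g (monomialF k ℓ)

/-- `σ` is the one-parameter subgroup of `SL(H⁰(C_ℓ, ω^n))` induced by the standard action on
`C_ℓ`, by pullback of forms. -/
def IsInducedSubgroup (g ℓ n : ℕ)
    (σ : kˣ →* SpecialLinearGroup k (sections g (monomialF k ℓ) n)) : Prop :=
  ∀ (t : kˣ) (s : sections g (monomialF k ℓ) n),
    (σ t s : Chart k × Chart k) =
      (scaleForm n t (t ^ ((g : ℤ) - ℓ)) s.1.1, scaleForm n t⁻¹ (t ^ (-(ℓ : ℤ) - 1)) s.1.2)

end Ribbon

end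

/-! ### Gluing schemes along open immersions, and products of such gluings -/

noncomputable section

namespace AlgebraicGeometry

open Limits

/-! Write g = ℓ + e + 1 and d = ℓ + e = g - 1. Both terms of y⁻¹ - y^(-ℓ-2) η have torus weight 1,
so the standard actions on the two charts agree on the overlap. They glue because a union of two
open subschemes is a pushout that stays a pushout after taking products.

On the overlap x^(-e-1) ε = y^(-ℓ-1) η, an invariant element of square zero. Elements y^a (1 + c
y^(-ℓ-1) η) multiply by adding a and c, and the gluing and the cocycle of ω are affine in (a, c)
(`glue_homog`, `transition_monomialF`). Hence H⁰(ω^n) has a basis of weight vectors: nd + 1 sections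
x^w + …, of weight w, and max(nd - d - 1, 0) nilpotent sections x^j ε, of weight j + e + 1. Products
of sections of ω span every H⁰(ω^n), n ≥ 1 (`sections_le_pow`). So the restriction maps are
surjective and the Hilbert points are non-zero.

For n = 1, the torus consists of automorphisms of the ribbon, so the Hilbert point is an eigenvector
whose character is the determinant on H⁰(ω^m), normalized to `SL` (`hilbertRep_torusSubgroup`). The
weights of the sections x^w + … are symmetric about md/2. The (m-1)d - 1 nilpotent ones have average
md/2 + (e - ℓ)/2. The character is therefore trivial exactly when e = ℓ. If it is non-trivial, no
invariant of positive degree survives at the point; if it is trivial, the point is fixed and both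
indices vanish.

For n ≥ 2, use the subgroup with one weight on the sections x^w + … and another on the nilpotent
ones. A product with two nilpotent factors is zero, so pulling back by the subgroup changes the
restriction map only by a diagonal map of H⁰(ω^(nm)) and a correction polynomial in t
(`exists_restrictSym_comp_twoStepMap`). Thus t moves the Hilbert point to t^K times a polynomial in
t. The inequality `destabilizing_weight_pos` gives K > 0 outside (g, n, m) = (3, 2, 2), so the orbit
tends to 0 and every invariant of positive degree vanishes (`not_isSemistable_of_forall_eq_sum`). -/

/-- A pullback square of jointly surjective open immersions is a pushout square. -/
theorem isPushout_of_isPullback_of_isOpenImmersion {U V W X : Scheme.{u}} {a : W ⟶ U} {b : W ⟶ V}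
    {i : U ⟶ X} {j : V ⟶ X} [IsOpenImmersion i] [IsOpenImmersion j] (h : IsPullback a b i j)
    (hs : ∀ x : X, x ∈ Set.range i ∨ x ∈ Set.range j) : IsPushout a b i j := by
  let 𝒰 : X.OpenCover :=
    { I₀ := Bool
      X := fun c => Bool.rec V U c
      f := fun c => match c with
        | true => i
        | false => j
      mem₀ := by
        rw [Scheme.presieve₀_mem_precoverage_iff]
        refine ⟨fun x => ?_, ?_⟩
        · rcases hs x with ⟨y, hy⟩ | ⟨y, hy⟩
          · exact ⟨true, y, hy⟩
          · exact ⟨false, y, hy⟩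
        · rintro (_ | _)
          · change IsOpenImmersion j; infer_instance
          · change IsOpenImmersion i; infer_instance }
  refine ⟨⟨h.w⟩, ⟨PushoutCocone.IsColimit.mk _ (fun s => ?_) (fun s => ?_) (fun s => ?_)
    (fun s m h1 h2 => ?_)⟩⟩
  · refine Scheme.Cover.glueMorphisms 𝒰 (fun c => match c with
        | true => s.inl
        | false => s.inr) ?_
    rintro (_ | _) (_ | _)
    · have : pullback.fst j j = pullback.snd j j := by rw [← cancel_mono j, pullback.condition]
      exact congrArg (· ≫ s.inr) this
    · change pullback.fst j i ≫ s.inr = pullback.snd j i ≫ s.inl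
      have e1 := h.flip.isoPullback_inv_fst
      have e2 := h.flip.isoPullback_inv_snd
      rw [← e1, ← e2, Category.assoc, Category.assoc, s.condition]
    · change pullback.fst i j ≫ s.inl = pullback.snd i j ≫ s.inr
      have e1 := h.isoPullback_inv_fst
      have e2 := h.isoPullback_inv_snd
      rw [← e1, ← e2, Category.assoc, Category.assoc, s.condition]
    · have : pullback.fst i i = pullback.snd i i := by rw [← cancel_mono i, pullback.condition]
      exact congrArg (· ≫ s.inl) this
  · exact Scheme.Cover.ι_glueMorphisms 𝒰 _ _ true
  · exact Scheme.Cover.ι_glueMorphisms 𝒰 _ _ false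
  · refine Scheme.Cover.hom_ext 𝒰 _ _ ?_
    rintro (_ | _)
    · refine Eq.trans h2 (Eq.symm ?_)
      exact Scheme.Cover.ι_glueMorphisms 𝒰 _ _ false
    · refine Eq.trans h1 (Eq.symm ?_)
      exact Scheme.Cover.ι_glueMorphisms 𝒰 _ _ true

/-- The pushout of two open immersions: the pushout square is a pullback square of jointly
surjective open immersions. -/
theorem isPullback_pushout_of_isOpenImmersion {U V W : Scheme.{u}} (a : W ⟶ U) (b : W ⟶ V)
    [IsOpenImmersion a] [IsOpenImmersion b] [HasPushout a b] :
    IsOpenImmersion (pushout.inl a b) ∧ IsOpenImmersion (pushout.inr a b) ∧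
    IsPullback a b (pushout.inl a b) (pushout.inr a b) ∧
    ∀ x : (pushout a b : Scheme.{u}),
      x ∈ Set.range (pushout.inl a b) ∨ x ∈ Set.range (pushout.inr a b) := by
  have : ∀ {i j} (q : i ⟶ j), IsOpenImmersion ((span a b).map q) := by
    rintro _ _ (_ | (_ | _))
    · simp only [WidePushoutShape.hom_id, CategoryTheory.Functor.map_id]; infer_instance
    · change IsOpenImmersion a; infer_instance
    · change IsOpenImmersion b; infer_instance
  have hi : IsOpenImmersion (pushout.inl a b) :=
    inferInstanceAs (IsOpenImmersion (colimit.ι (span a b) WalkingSpan.left))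
  have hj : IsOpenImmersion (pushout.inr a b) :=
    inferInstanceAs (IsOpenImmersion (colimit.ι (span a b) WalkingSpan.right))
  refine ⟨hi, hj, ?_, fun x => ?_⟩
  · let φ : W ⟶ pullback (pushout.inl a b) (pushout.inr a b) :=
      pullback.lift a b pushout.condition
    have h1 : φ ≫ pullback.fst _ _ = a := pullback.lift_fst _ _ _
    have h2 : φ ≫ pullback.snd _ _ = b := pullback.lift_snd _ _ _
    have : IsOpenImmersion φ := by
      have : IsOpenImmersion (φ ≫ pullback.fst _ _) := by rw [h1]; infer_instance
      exact IsOpenImmersion.of_comp φ (pullback.fst _ _)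
    have hsurj : Function.Surjective φ := by
      intro x
      have hx : pushout.inl a b (pullback.fst (pushout.inl a b) (pushout.inr a b) x) =
          pushout.inr a b (pullback.snd (pushout.inl a b) (pushout.inr a b) x) := by
        rw [← Scheme.Hom.comp_apply, ← Scheme.Hom.comp_apply, pullback.condition]
      obtain ⟨k, fi, fj, y, hy1, hy2⟩ :=
        (Scheme.IsLocallyDirected.ι_eq_ι_iff (span a b) (i := WalkingSpan.left)
          (j := WalkingSpan.right)).mp hx
      -- The points agree through some object of the span mapping to both legs. That object is the
      -- apex, since there is no arrow from one leg to the other.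
      have hk : ∃ z : W, a z = pullback.fst (pushout.inl a b) (pushout.inr a b) x := by
        rcases fi with _ | _
        · nomatch fj
        · exact ⟨y, hy1⟩
      obtain ⟨z, hz⟩ := hk
      refine ⟨z, (pullback.fst (pushout.inl a b) (pushout.inr a b)).isOpenEmbedding.injective ?_⟩
      rw [← Scheme.Hom.comp_apply, h1, hz]
    have : Epi φ.base := (TopCat.epi_iff_surjective _).mpr hsurj
    have : IsIso φ := IsOpenImmersion.isIso φ
    exact IsPullback.of_iso_pullback ⟨pushout.condition⟩ (asIso φ) h1 h2
  · obtain ⟨k, y, hy⟩ := Scheme.IsLocallyDirected.ι_jointly_surjective (span a b) x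
    rcases k with _ | (_ | _)
    · refine Or.inl ⟨a (show W from y), Eq.trans ?_ hy⟩
      exact congr($(colimit.w (span a b) WalkingSpan.Hom.fst) y)
    · exact Or.inl ⟨y, hy⟩
    · exact Or.inr ⟨y, hy⟩

/-- Products commute with the gluing of two open subschemes. -/
theorem isPushout_whiskerLeft {S : Scheme.{u}} (M : Over S) {U V W X : Over S} {a : W ⟶ U}
    {b : W ⟶ V} {i : U ⟶ X} {j : V ⟶ X} [IsOpenImmersion i.left] [IsOpenImmersion j.left]
    (h : IsPullback a.left b.left i.left j.left)
    (hs : ∀ x : X.left, x ∈ Set.range i.left ∨ x ∈ Set.range j.left) :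
    IsPushout (M ◁ a) (M ◁ b) (M ◁ i) (M ◁ j) := by
  -- `M ◁ q` is the base change of `q` along a projection. Hence open immersions, pullback squares
  -- and joint surjectivity all pass to the product with `M`.
  have hsq : ∀ {Y Z : Over S} (q : Y ⟶ Z), IsPullback (M ◁ q).left
      (pullback.snd M.hom Y.hom) (pullback.snd M.hom Z.hom) q.left := by
    intro Y Z q
    refine IsPullback.of_right (h₁₂ := pullback.fst M.hom Z.hom) (v₁₃ := M.hom) (h₂₂ := Z.hom) ?_
      (Over.whiskerLeft_left_snd q) (IsPullback.of_hasPullback _ _)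
    rw [Over.whiskerLeft_left_fst, Over.w]
    exact IsPullback.of_hasPullback _ _
  have hpb : IsPullback (M ◁ a).left (M ◁ b).left (M ◁ i).left (M ◁ j).left := by
    refine (IsPullback.of_right (h₁₂ := pullback.snd M.hom V.hom) (v₁₃ := j.left)
      (h₂₂ := pullback.snd M.hom X.hom) ?_ ?_ (hsq j).flip).flip
    · rw [Over.whiskerLeft_left_snd, Over.whiskerLeft_left_snd]
      exact (hsq a).flip.paste_horiz h.flip
    · have hw : a ≫ i = b ≫ j := Over.OverMorphism.ext h.w
      rw [← Over.comp_left, ← Over.comp_left, ← whiskerLeft_comp, ← whiskerLeft_comp, hw]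
  have : IsOpenImmersion (M ◁ i).left :=
    MorphismProperty.of_isPullback (P := @IsOpenImmersion) (hsq i).flip inferInstance
  have : IsOpenImmersion (M ◁ j).left :=
    MorphismProperty.of_isPullback (P := @IsOpenImmersion) (hsq j).flip inferInstance
  have hs' : ∀ x : (M ⊗ X).left,
      x ∈ Set.range (M ◁ i).left ∨ x ∈ Set.range (M ◁ j).left := by
    intro x
    rcases hs (pullback.snd M.hom X.hom x) with ⟨y, hy⟩ | ⟨y, hy⟩
    · obtain ⟨z, hz, -⟩ := Scheme.exists_preimage_of_isPullback (hsq i) x y hy.symm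
      exact Or.inl ⟨z, hz⟩
    · obtain ⟨z, hz, -⟩ := Scheme.exists_preimage_of_isPullback (hsq j) x y hy.symm
      exact Or.inr ⟨z, hz⟩
  have hpo := isPushout_of_isPullback_of_isOpenImmersion hpb hs'
  refine ⟨⟨Over.OverMorphism.ext hpo.w⟩, ⟨PushoutCocone.IsColimit.mk _
    (fun s => Over.homMk (hpo.desc s.inl.left s.inr.left congr(($s.condition).left)) ?_)
    (fun s => ?_) (fun s => ?_) (fun s m h1 h2 => ?_)⟩⟩
  · apply hpo.hom_ext
    · rw [hpo.inl_desc_assoc, Over.w, Over.w]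
    · rw [hpo.inr_desc_assoc, Over.w, Over.w]
  · exact Over.OverMorphism.ext (hpo.inl_desc _ _ _)
  · exact Over.OverMorphism.ext (hpo.inr_desc _ _ _)
  · refine Over.OverMorphism.ext (hpo.hom_ext ?_ ?_)
    · refine Eq.trans ?_ (hpo.inl_desc _ _ _).symm
      exact congr(($h1).left)
    · refine Eq.trans ?_ (hpo.inr_desc _ _ _).symm
      exact congr(($h2).left)

end AlgebraicGeometry

end

noncomputable section

/-! ### Module objects and monoidal functors -/

namespace CategoryTheory

open Functor.LaxMonoidal in
/-- The image of a module object under a lax monoidal functor. -/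
abbrev ModObj.mapFunctor {C D : Type*} [Category* C] [Category* D] [MonoidalCategory C]
    [MonoidalCategory D] (F : C ⥤ D) [F.LaxMonoidal] {M : C} [MonObj M] {X : C} [ModObj M X] :
    letI := F.monObjObj (X := M)
    ModObj (F.obj M) (F.obj X) :=
  letI := F.monObjObj (X := M)
  let s : M ⊗ X ⟶ X := ModObj.smul (M := M) (X := X)
  { smul := μ F M X ≫ F.map s
    one_smul := by
      have h : MonObj.one (X := M) ▷ X ≫ s = (λ_ X).hom := ModObj.one_smul (M := M) X
      change (Functor.LaxMonoidal.ε F ≫ F.map MonObj.one) ▷ F.obj X ≫ μ F M X ≫ F.map s = (λ_ (F.obj X)).hom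
      rw [comp_whiskerRight, Category.assoc, μ_natural_left_assoc, ← F.map_comp, h]
      exact (left_unitality F X).symm
    mul_smul := by
      have h : MonObj.mul (X := M) ▷ X ≫ s = (α_ M M X).hom ≫ M ◁ s ≫ s :=
        ModObj.mul_smul (M := M) X
      change (μ F M M ≫ F.map MonObj.mul) ▷ F.obj X ≫ μ F M X ≫ F.map s =
        (α_ (F.obj M) (F.obj M) (F.obj X)).hom ≫
          F.obj M ◁ (μ F M X ≫ F.map s) ≫ μ F M X ≫ F.map s
      rw [comp_whiskerRight, Category.assoc, μ_natural_left_assoc, ← F.map_comp, h,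
        MonoidalCategory.whiskerLeft_comp, Category.assoc, μ_natural_right_assoc, F.map_comp,
        F.map_comp]
      simp only [← Category.assoc]
      congr 2
      simp }

end CategoryTheory

namespace Ribbon

open TensorProduct

variable {k : Type u} [Field k]

/-! ### Coactions of `k[T, T⁻¹]` on the charts -/

theorem chart_algHom_ext {B : Type*} [Semiring B] [Algebra k B] {φ ψ : Chart k →ₐ[k] B}
    (h1 : φ (TrivSqZeroExt.inl Polynomial.X) = ψ (TrivSqZeroExt.inl Polynomial.X))
    (h2 : φ DualNumber.eps = ψ DualNumber.eps) : φ = ψ := by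
  have h : φ.comp (TrivSqZeroExt.inlAlgHom k _ _) = ψ.comp (TrivSqZeroExt.inlAlgHom k _ _) :=
    Polynomial.algHom_ext h1
  refine DualNumber.algHom_ext' h (LinearMap.ext fun p => ?_)
  have hp : p • (DualNumber.eps : Chart k) = TrivSqZeroExt.inl p * DualNumber.eps := by
    rw [DualNumber.eps, TrivSqZeroExt.inl_mul_inr]; ext1 <;> simp
  change φ (p • DualNumber.eps) = ψ (p • DualNumber.eps)
  rw [hp, map_mul, map_mul, h2]
  exact congrArg (· * _) (DFunLike.congr_fun h p)

/-- The algebra homomorphism from dual numbers to a commutative algebra with given values. -/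
def dualNumberLift {A B : Type*} [CommRing A] [Algebra k A] [CommRing B] [Algebra k B]
    (φ : A →ₐ[k] B) (e : B) (he : e * e = 0) : DualNumber A →ₐ[k] B :=
  DualNumber.lift ⟨(φ, e), he, fun a => mul_comm e (φ a)⟩

section

variable {A B : Type*} [CommRing A] [Algebra k A] [CommRing B] [Algebra k B] (φ : A →ₐ[k] B)
  (e : B) (he : e * e = 0)

theorem dualNumberLift_inl (a : A) : dualNumberLift φ e he (TrivSqZeroExt.inl a) = φ a := by
  rw [dualNumberLift, DualNumber.lift_apply_apply]
  simp

theorem dualNumberLift_eps : dualNumberLift φ e he DualNumber.eps = e :=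
  DualNumber.lift_apply_eps _

end

variable (k) in
/-- The coaction `z ↦ T^a ⊗ z`, `ε ↦ T^b ⊗ ε` on a chart. -/
def chartCoaction (a b : ℤ) : Chart k →ₐ[k] k[T;T⁻¹] ⊗[k] Chart k :=
  dualNumberLift (k := k) (B := k[T;T⁻¹] ⊗[k] Chart k)
    (Polynomial.aeval (LaurentPolynomial.T a ⊗ₜ[k] TrivSqZeroExt.inl Polynomial.X))
    (LaurentPolynomial.T b ⊗ₜ[k] DualNumber.eps) (by simp)

variable (k) in
/-- The coaction `y ↦ T^a ⊗ y`, `η ↦ T^b ⊗ η` on the overlap. -/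
def overlapCoaction (a b : ℤ) : Overlap k →ₐ[k] k[T;T⁻¹] ⊗[k] Overlap k :=
  dualNumberLift (k := k) (B := k[T;T⁻¹] ⊗[k] Overlap k) (AddMonoidAlgebra.lift k _ ℤ
    { toFun := fun n => LaurentPolynomial.T (a * n.toAdd) ⊗ₜ
        TrivSqZeroExt.inl (LaurentPolynomial.T n.toAdd)
      map_one' := by
        simp only [toAdd_one, mul_zero, LaurentPolynomial.T_zero, TrivSqZeroExt.inl_one]
        rfl
      map_mul' := fun m n => by
        rw [toAdd_mul, mul_add, LaurentPolynomial.T_add, LaurentPolynomial.T_add,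
          TrivSqZeroExt.inl_mul, Algebra.TensorProduct.tmul_mul_tmul] })
    (LaurentPolynomial.T b ⊗ₜ[k] DualNumber.eps) (by simp)

theorem chartCoaction_X (a b : ℤ) :
    chartCoaction k a b (TrivSqZeroExt.inl Polynomial.X) =
      LaurentPolynomial.T a ⊗ₜ[k] TrivSqZeroExt.inl Polynomial.X := by
  rw [chartCoaction, dualNumberLift_inl, Polynomial.aeval_X]

theorem chartCoaction_eps (a b : ℤ) :
    chartCoaction k a b DualNumber.eps = LaurentPolynomial.T b ⊗ₜ[k] DualNumber.eps :=
  dualNumberLift_eps _ _ _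

theorem overlapCoaction_T (a b n : ℤ) :
    overlapCoaction k a b (TrivSqZeroExt.inl (LaurentPolynomial.T n)) =
      LaurentPolynomial.T (a * n) ⊗ₜ[k] TrivSqZeroExt.inl (LaurentPolynomial.T n) := by
  rw [overlapCoaction, dualNumberLift_inl]
  refine (AddMonoidAlgebra.lift_single _ _ _).trans ?_
  rw [one_smul]
  rfl

theorem overlapCoaction_eps (a b : ℤ) :
    overlapCoaction k a b DualNumber.eps = LaurentPolynomial.T b ⊗ₜ[k] DualNumber.eps :=
  dualNumberLift_eps _ _ _

theorem overlapCoaction_inr_T (a b n : ℤ) :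
    overlapCoaction k a b (TrivSqZeroExt.inr (LaurentPolynomial.T n)) =
      LaurentPolynomial.T (a * n + b) ⊗ₜ[k] TrivSqZeroExt.inr (LaurentPolynomial.T n) := by
  have h : (TrivSqZeroExt.inr (LaurentPolynomial.T n) : Overlap k) =
      TrivSqZeroExt.inl (LaurentPolynomial.T n) * DualNumber.eps := by
    rw [DualNumber.eps, TrivSqZeroExt.inl_mul_inr, smul_eq_mul, mul_one]
  rw [h, map_mul, overlapCoaction_T, overlapCoaction_eps, Algebra.TensorProduct.tmul_mul_tmul,
    LaurentPolynomial.T_add]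

theorem restrict_X : restrict (k := k) (TrivSqZeroExt.inl Polynomial.X) =
    TrivSqZeroExt.inl (LaurentPolynomial.T 1) := by
  simp [restrict_eq]

theorem restrict_eps : restrict (k := k) DualNumber.eps = DualNumber.eps := by
  rw [restrict_eq, DualNumber.eps]
  ext1 <;> simp

theorem restrict_comp_chartCoaction (a b : ℤ) :
    (Algebra.TensorProduct.map (.id k k[T;T⁻¹]) (restrict (k := k))).comp (chartCoaction k a b) =
      (overlapCoaction k a b).comp restrict := by
  apply chart_algHom_ext
  · simp only [AlgHom.comp_apply, chartCoaction_X, Algebra.TensorProduct.map_tmul, restrict_X,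
      overlapCoaction_T, mul_one, AlgHom.id_apply]
  · simp only [AlgHom.comp_apply, chartCoaction_eps, Algebra.TensorProduct.map_tmul, restrict_eps,
      overlapCoaction_eps, AlgHom.id_apply]

theorem glue_T (g : ℕ) (f : k[T;T⁻¹]) (n : ℤ) :
    glue g f (TrivSqZeroExt.inl (LaurentPolynomial.T n)) =
      ((xUnit f ^ n : (Overlap k)ˣ) : Overlap k) := by
  rw [glue, DualNumber.lift_apply_apply, TrivSqZeroExt.fst_inl, TrivSqZeroExt.snd_inl, map_zero,
    zero_mul, add_zero]
  refine (AddMonoidAlgebra.lift_single _ _ _).trans ?_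
  rw [one_smul]
  rfl

theorem glue_eps (g : ℕ) (f : k[T;T⁻¹]) :
    glue g f DualNumber.eps = TrivSqZeroExt.inr (LaurentPolynomial.T (-(g : ℤ) - 1)) := by
  rw [DualNumber.eps, glue_inr]; simp

/-- Equivariance of the gluing: with y of weight -1 and η of weight -ℓ-1, both y⁻¹ and y^(-ℓ-2) η
have weight 1, and y^(-g-1) η has weight g - ℓ. The choice f = y^(-ℓ) is what makes the first two
weights equal. -/
theorem glue_comp_chartCoaction (g ℓ : ℕ) :
    (Algebra.TensorProduct.map (.id k k[T;T⁻¹])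
        ((glue g (monomialF k ℓ)).comp restrict)).comp (chartCoaction k 1 ((g : ℤ) - ℓ)) =
      (overlapCoaction k (-1) (-(ℓ : ℤ) - 1)).comp ((glue g (monomialF k ℓ)).comp restrict) := by
  apply chart_algHom_ext
  · simp only [AlgHom.comp_apply, chartCoaction_X, Algebra.TensorProduct.map_tmul, restrict_X,
      glue_T, zpow_one, AlgHom.id_apply]
    simp only [xUnit, monomialF, ← LaurentPolynomial.T_add, map_sub, overlapCoaction_T,
      overlapCoaction_inr_T, TensorProduct.tmul_sub]
    congr 3
    ring_nf
  · simp only [AlgHom.comp_apply, chartCoaction_eps, Algebra.TensorProduct.map_tmul, restrict_eps,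
      glue_eps, overlapCoaction_inr_T, AlgHom.id_apply]
    congr 2; ring

/-- The action of the multiplicative group on a chart. -/
abbrev chartModObj (a b : ℤ) :
    ModObj (Opposite.op (CommAlgCat.of k k[T;T⁻¹])) (Opposite.op (CommAlgCat.of k (Chart k))) where
  smul := (CommAlgCat.ofHom (chartCoaction k a b)).op
  one_smul := by
    apply Quiver.Hom.unop_inj
    apply CommAlgCat.hom_ext
    have h : ∀ n : ℤ, Bialgebra.counitAlgHom k k[T;T⁻¹] (LaurentPolynomial.T n) = 1 := fun n => by
      simp
    apply chart_algHom_ext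
    · change Algebra.TensorProduct.map (Bialgebra.counitAlgHom k k[T;T⁻¹]) (.id k (Chart k))
        (chartCoaction k a b (TrivSqZeroExt.inl Polynomial.X)) =
          (1 : k) ⊗ₜ[k] TrivSqZeroExt.inl Polynomial.X
      rw [chartCoaction_X, Algebra.TensorProduct.map_tmul, h, AlgHom.id_apply]
    · change Algebra.TensorProduct.map (Bialgebra.counitAlgHom k k[T;T⁻¹]) (.id k (Chart k))
        (chartCoaction k a b DualNumber.eps) = (1 : k) ⊗ₜ[k] DualNumber.eps
      rw [chartCoaction_eps, Algebra.TensorProduct.map_tmul, h, AlgHom.id_apply]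
  mul_smul := by
    apply Quiver.Hom.unop_inj
    apply CommAlgCat.hom_ext
    have h : ∀ n : ℤ, Bialgebra.comulAlgHom k k[T;T⁻¹] (LaurentPolynomial.T n) =
        LaurentPolynomial.T n ⊗ₜ[k] LaurentPolynomial.T n := fun n => by
      simp
    apply chart_algHom_ext
    · change Algebra.TensorProduct.map (Bialgebra.comulAlgHom k k[T;T⁻¹]) (.id k (Chart k))
        (chartCoaction k a b (TrivSqZeroExt.inl Polynomial.X)) =
          (Algebra.TensorProduct.assoc k k k k[T;T⁻¹] k[T;T⁻¹] (Chart k)).symm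
            (Algebra.TensorProduct.map (.id k k[T;T⁻¹]) (chartCoaction k a b)
              (chartCoaction k a b (TrivSqZeroExt.inl Polynomial.X)))
      simp only [chartCoaction_X, Algebra.TensorProduct.map_tmul, h, AlgHom.id_apply,
        Algebra.TensorProduct.assoc_symm_tmul]
    · change Algebra.TensorProduct.map (Bialgebra.comulAlgHom k k[T;T⁻¹]) (.id k (Chart k))
        (chartCoaction k a b DualNumber.eps) =
          (Algebra.TensorProduct.assoc k k k k[T;T⁻¹] k[T;T⁻¹] (Chart k)).symm
            (Algebra.TensorProduct.map (.id k k[T;T⁻¹]) (chartCoaction k a b)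
              (chartCoaction k a b DualNumber.eps))
      simp only [chartCoaction_eps, Algebra.TensorProduct.map_tmul, h, AlgHom.id_apply,
        Algebra.TensorProduct.assoc_symm_tmul]

end Ribbon

end

/-! ### The action of the multiplicative group on the glued ribbon -/

noncomputable section

namespace CategoryTheory

/-- Actions of a monoid object on two objects glue along a pushout that is stable under products. -/
theorem exists_modObj_of_isPushout {D : Type*} [Category* D] [MonoidalCategory D] {G : D}
    [MonObj G] {W U V X : D} {a : W ⟶ U} {b : W ⟶ V} {i : U ⟶ X} {j : V ⟶ X}
    (h : ∀ M : D, IsPushout (M ◁ a) (M ◁ b) (M ◁ i) (M ◁ j)) (hw : a ≫ i = b ≫ j)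
    (ρU : ModObj G U) (ρV : ModObj G V) (s : G ⊗ W ⟶ W)
    (ha : G ◁ a ≫ ρU.smul = s ≫ a) (hb : G ◁ b ≫ ρV.smul = s ≫ b) :
    ∃ ρ : ModObj G X, G ◁ i ≫ ρ.smul = ρU.smul ≫ i ∧ G ◁ j ≫ ρ.smul = ρV.smul ≫ j := by
  let sU : G ⊗ U ⟶ U := ρU.smul
  let sV : G ⊗ V ⟶ V := ρV.smul
  have hcomp : G ◁ a ≫ sU ≫ i = G ◁ b ≫ sV ≫ j := by
    rw [← Category.assoc, ← Category.assoc]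
    change (G ◁ a ≫ ρU.smul) ≫ i = (G ◁ b ≫ ρV.smul) ≫ j
    rw [ha, hb, Category.assoc, Category.assoc, hw]
  let σ : G ⊗ X ⟶ X := (h G).desc (sU ≫ i) (sV ≫ j) hcomp
  have hi : G ◁ i ≫ σ = sU ≫ i := (h G).inl_desc _ _ _
  have hj : G ◁ j ≫ σ = sV ≫ j := (h G).inr_desc _ _ _
  have key1 : ∀ {Y : D} (q : Y ⟶ X) (sY : G ⊗ Y ⟶ Y), G ◁ q ≫ σ = sY ≫ q →
      MonObj.one (X := G) ▷ Y ≫ sY = (λ_ Y).hom →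
      𝟙_ D ◁ q ≫ MonObj.one (X := G) ▷ X ≫ σ = 𝟙_ D ◁ q ≫ (λ_ X).hom := by
    intro Y q sY hq h1
    rw [← Category.assoc, whisker_exchange, Category.assoc, hq, ← Category.assoc, h1,
      leftUnitor_naturality]
  have key2 : ∀ {Y : D} (q : Y ⟶ X) (sY : G ⊗ Y ⟶ Y), G ◁ q ≫ σ = sY ≫ q →
      MonObj.mul (X := G) ▷ Y ≫ sY = (α_ G G Y).hom ≫ G ◁ sY ≫ sY →
      (G ⊗ G) ◁ q ≫ MonObj.mul (X := G) ▷ X ≫ σ =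
        (G ⊗ G) ◁ q ≫ (α_ G G X).hom ≫ G ◁ σ ≫ σ := by
    intro Y q sY hq h1
    rw [← Category.assoc, whisker_exchange, Category.assoc, hq, ← Category.assoc, h1,
      associator_naturality_right_assoc, ← MonoidalCategory.whiskerLeft_comp_assoc, hq,
      MonoidalCategory.whiskerLeft_comp_assoc, hq]
    simp only [Category.assoc]
  refine ⟨{ smul := σ, one_smul := ?_, mul_smul := ?_ }, hi, hj⟩
  -- The axioms compare maps out of `𝟙_ D ⊗ X` and `(G ⊗ G) ⊗ X`. These are pushouts as well, so it
  -- suffices to check on the two pieces; this is why `h` is needed for every `M`.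
  · exact (h (𝟙_ D)).hom_ext (key1 i sU hi ρU.one_smul) (key1 j sV hj ρV.one_smul)
  · exact (h (G ⊗ G)).hom_ext (key2 i sU hi ρU.mul_smul) (key2 j sV hj ρV.mul_smul)

end CategoryTheory

namespace Ribbon

open Limits Opposite

variable {k : Type u} [Field k]

variable (k) in
/-- A chart as a scheme over `k`. -/
abbrev chartOver : Over (Spec (.of k)) := (algSpec (.of k)).obj (op (.of k (Chart k)))

instance : (algSpec (CommRingCat.of k)).Braided := braidedAlgSpec

theorem overlap_condition (g : ℕ) (f : k[T;T⁻¹]) :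
    overlapToFst g f ≫ fstChart g f = overlapToSnd k ≫ sndChart g f :=
  pushout.condition

theorem fstChart_comp_hom (g : ℕ) (f : k[T;T⁻¹]) :
    fstChart g f ≫ (overScheme g f).hom = (chartOver k).hom :=
  pushout.inl_desc _ _ _

theorem sndChart_comp_hom (g : ℕ) (f : k[T;T⁻¹]) :
    sndChart g f ≫ (overScheme g f).hom = (chartOver k).hom :=
  pushout.inr_desc _ _ _

/-- The inclusion of the first chart, over `k`. -/
def fstChartOver (g : ℕ) (f : k[T;T⁻¹]) : chartOver k ⟶ overScheme g f :=
  Over.homMk (fstChart g f) (fstChart_comp_hom g f)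

/-- The inclusion of the second chart, over `k`. -/
def sndChartOver (g : ℕ) (f : k[T;T⁻¹]) : chartOver k ⟶ overScheme g f :=
  Over.homMk (sndChart g f) (sndChart_comp_hom g f)

/-- The morphism of affine schemes over `k` given by a homomorphism of algebras. -/
abbrev specMap {A B : Type u} [CommRing A] [CommRing B] [Algebra k A] [Algebra k B]
    (φ : A →ₐ[k] B) : (algSpec (.of k)).obj (op (.of k B)) ⟶ (algSpec (.of k)).obj (op (.of k A)) :=
  (algSpec (.of k)).map (CommAlgCat.ofHom φ).op

theorem isPushout_whiskerLeft_charts (g : ℕ) (f : k[T;T⁻¹]) (M : Over (Spec (.of k))) :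
    IsPushout (M ◁ specMap ((glue g f).comp restrict)) (M ◁ specMap (restrict (k := k)))
      (M ◁ fstChartOver g f) (M ◁ sndChartOver g f) := by
  obtain ⟨h1, h2, h3, h4⟩ :=
    isPullback_pushout_of_isOpenImmersion (overlapToFst g f) (overlapToSnd k)
  have : IsOpenImmersion (fstChartOver g f).left := h1
  have : IsOpenImmersion (sndChartOver g f).left := h2
  exact isPushout_whiskerLeft M h3 h4

open TensorProduct in
/-- The morphism `𝔾ₘ × Spec A ⟶ Spec A` given by `A → k[T, T⁻¹] ⊗ A`. -/
def coactionSpec {A : Type u} [CommRing A] [Algebra k A] (φ : A →ₐ[k] k[T;T⁻¹] ⊗[k] A) :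
    Gm k ⊗ (algSpec (.of k)).obj (op (.of k A)) ⟶ (algSpec (.of k)).obj (op (.of k A)) :=
  Functor.LaxMonoidal.μ (algSpec (.of k)) (op (.of k k[T;T⁻¹])) (op (.of k A)) ≫
    (algSpec (.of k)).map (X := op (.of k k[T;T⁻¹]) ⊗ op (.of k A)) (CommAlgCat.ofHom φ).op

open TensorProduct in
-- A homomorphism of comodule algebras induces an equivariant morphism of spectra. This turns the
-- two identities between coactions into the hypotheses of the gluing of actions.
theorem whiskerLeft_specMap_coactionSpec {A B : Type u} [CommRing A] [CommRing B] [Algebra k A]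
    [Algebra k B] (ψ : A →ₐ[k] B) (φ : A →ₐ[k] k[T;T⁻¹] ⊗[k] A) (χ : B →ₐ[k] k[T;T⁻¹] ⊗[k] B)
    (h : (Algebra.TensorProduct.map (.id k k[T;T⁻¹]) ψ).comp φ = χ.comp ψ) :
    Gm k ◁ specMap ψ ≫ coactionSpec φ = coactionSpec χ ≫ specMap ψ := by
  have h1 := Functor.LaxMonoidal.μ_natural_right (algSpec (.of k)) (op (.of k k[T;T⁻¹]))
    (CommAlgCat.ofHom ψ).op
  have h2 : (op (CommAlgCat.of k k[T;T⁻¹]) ◁ (CommAlgCat.ofHom ψ).op) ≫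
      (show op (CommAlgCat.of k k[T;T⁻¹]) ⊗ op (CommAlgCat.of k A) ⟶ op (CommAlgCat.of k A) from
        (CommAlgCat.ofHom φ).op) =
      (show op (CommAlgCat.of k k[T;T⁻¹]) ⊗ op (CommAlgCat.of k B) ⟶ op (CommAlgCat.of k B) from
        (CommAlgCat.ofHom χ).op) ≫ (CommAlgCat.ofHom ψ).op := by
    apply Quiver.Hom.unop_inj
    apply CommAlgCat.hom_ext
    exact h
  have h3 := congrArg (algSpec (.of k)).map h2
  rw [Functor.map_comp, Functor.map_comp] at h3
  rw [coactionSpec, coactionSpec]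
  refine (Category.assoc _ _ _).symm.trans ((congrArg (· ≫ _) h1).trans ?_)
  refine (Category.assoc _ _ _).trans ((congrArg (_ ≫ ·) h3).trans ?_)
  exact (Category.assoc _ _ _).symm

/-- The action of the multiplicative group on a chart. -/
@[reducible]
def chartOverModObj (a b : ℤ) : ModObj (Gm k) (chartOver k) :=
  letI := chartModObj (k := k) a b
  ModObj.mapFunctor (algSpec (.of k)) (M := op (.of k k[T;T⁻¹])) (X := op (.of k (Chart k)))

/-- The value of Laurent polynomials at `t`. -/
def evalAlgHom (t : kˣ) : k[T;T⁻¹] →ₐ[k] k where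
  toRingHom := LaurentPolynomial.eval₂ (RingHom.id k) t
  commutes' := LaurentPolynomial.eval₂_C (RingHom.id k) t

theorem evalAlgHom_T (t : kˣ) (n : ℤ) :
    evalAlgHom t (LaurentPolynomial.T n) = ((t ^ n : kˣ) : k) :=
  LaurentPolynomial.eval₂_T _ _ _

open TensorProduct in
theorem point_whiskerRight_coactionSpec {A : Type u} [CommRing A] [Algebra k A]
    (φ : A →ₐ[k] k[T;T⁻¹] ⊗[k] A) (t : kˣ) (ψ : A →ₐ[k] A)
    (h : ((Algebra.TensorProduct.lid k A).toAlgHom.comp (Algebra.TensorProduct.map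
      (evalAlgHom t) (.id k A))).comp φ = ψ) :
    (λ_ _).inv ≫ (Gm.point t ▷ (algSpec (.of k)).obj (op (.of k A))) ≫ coactionSpec φ =
      specMap ψ := by
  let F := algSpec (CommRingCat.of k)
  let p : 𝟙_ (CommAlgCat k)ᵒᵖ ⟶ op (CommAlgCat.of k k[T;T⁻¹]) := (CommAlgCat.ofHom (evalAlgHom t)).op
  have h0 : Gm.point t = Functor.LaxMonoidal.ε F ≫ F.map p := by
    apply Over.OverMorphism.ext
    exact (Category.id_comp _).symm
  let a : op (CommAlgCat.of k k[T;T⁻¹]) ⊗ op (CommAlgCat.of k A) ⟶ op (CommAlgCat.of k A) :=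
    (CommAlgCat.ofHom φ).op
  have h1 : (λ_ (op (CommAlgCat.of k A))).inv ≫ p ▷ op (CommAlgCat.of k A) ≫ a =
      (CommAlgCat.ofHom ψ).op := by
    apply Quiver.Hom.unop_inj
    apply CommAlgCat.hom_ext
    exact h
  have h2 : coactionSpec φ = Functor.LaxMonoidal.μ F _ _ ≫ F.map a := rfl
  have h3 : specMap ψ = F.map ((λ_ (op (CommAlgCat.of k A))).inv ≫ p ▷ op (CommAlgCat.of k A) ≫ a) :=
    by rw [h1]
  rw [h0, h2, h3, F.map_comp, F.map_comp, ← Functor.LaxMonoidal.left_unitality_inv]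
  have h4 := Functor.LaxMonoidal.μ_natural_left F p (op (CommAlgCat.of k A))
  change (λ_ (F.obj (op (CommAlgCat.of k A)))).inv ≫ (Functor.LaxMonoidal.ε F ≫ F.map p) ▷
    F.obj (op (CommAlgCat.of k A)) ≫ Functor.LaxMonoidal.μ F _ _ ≫ F.map a = _
  rw [comp_whiskerRight]
  simp only [Category.assoc]
  rw [reassoc_of% h4]

/-- An equivariant morphism intertwines the automorphisms given by a point `t`, so the action on the
ribbon can be read off on a chart. -/
theorem actBy_of_whiskerLeft {C : Over (Spec (.of k))} (ρ : ModObj (Gm k) C)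
    {U : Over (Spec (.of k))} {i : U ⟶ C} {s : Gm k ⊗ U ⟶ U} (h : Gm k ◁ i ≫ ρ.smul = s ≫ i)
    (t : kˣ) {ψ : U ⟶ U} (hψ : (λ_ U).inv ≫ (Gm.point t ▷ U) ≫ s = ψ) :
    i ≫ actBy ρ t = ψ ≫ i := by
  rw [actBy, leftUnitor_inv_naturality_assoc, ← Category.assoc (_ ◁ i), whisker_exchange,
    Category.assoc]
  refine Eq.trans (congrArg (fun q => (λ_ U).inv ≫ (Gm.point t ▷ U) ≫ q) h) ?_
  rw [← hψ]
  simp only [Category.assoc]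

open TensorProduct in
theorem scale_eq_comp_chartCoaction (t : kˣ) (a b : ℤ) :
    ((Algebra.TensorProduct.lid k (Chart k)).toAlgHom.comp (Algebra.TensorProduct.map
      (evalAlgHom t) (.id k (Chart k)))).comp (chartCoaction k a b) = scale (t ^ a) (t ^ b) := by
  apply chart_algHom_ext
  · change Algebra.TensorProduct.lid k (Chart k) (Algebra.TensorProduct.map
      (evalAlgHom t) (.id k (Chart k)) (chartCoaction k a b (TrivSqZeroExt.inl Polynomial.X))) = _
    rw [chartCoaction_X, Algebra.TensorProduct.map_tmul, Algebra.TensorProduct.lid_tmul,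
      evalAlgHom_T, AlgHom.id_apply, scale, DualNumber.lift_apply_apply]
    ext1 <;> simp [Polynomial.smul_eq_C_mul]
  · change Algebra.TensorProduct.lid k (Chart k) (Algebra.TensorProduct.map
      (evalAlgHom t) (.id k (Chart k)) (chartCoaction k a b DualNumber.eps)) = _
    rw [chartCoaction_eps, Algebra.TensorProduct.map_tmul, Algebra.TensorProduct.lid_tmul,
      evalAlgHom_T, AlgHom.id_apply, scale, DualNumber.lift_apply_eps]
    rw [DualNumber.eps, ← TrivSqZeroExt.inr_smul, Polynomial.smul_eq_C_mul, mul_one]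

/-- The multiplicative group acts on `C_ℓ` by `t · (x, y, ε, η) = (t x, t⁻¹ y, t^(g-ℓ) ε, t^(-ℓ-1) η)`. -/
theorem exists_isStandardAction (g ℓ : ℕ) :
    ∃ ρ : ModObj (Gm k) (overScheme g (monomialF k ℓ)), IsStandardAction g ℓ ρ := by
  have hw : specMap ((glue g (monomialF k ℓ)).comp restrict) ≫ fstChartOver g (monomialF k ℓ) =
      specMap (restrict (k := k)) ≫ sndChartOver g (monomialF k ℓ) :=
    Over.OverMorphism.ext (overlap_condition g _)
  obtain ⟨ρ, h1, h2⟩ := exists_modObj_of_isPushout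
    (isPushout_whiskerLeft_charts g (monomialF k ℓ)) hw
    (chartOverModObj 1 ((g : ℤ) - ℓ)) (chartOverModObj (-1) (-(ℓ : ℤ) - 1))
    (coactionSpec (overlapCoaction k (-1) (-(ℓ : ℤ) - 1)))
    (whiskerLeft_specMap_coactionSpec _ _ _ (glue_comp_chartCoaction g ℓ))
    (whiskerLeft_specMap_coactionSpec _ _ _ (restrict_comp_chartCoaction _ _))
  refine ⟨ρ, fun t => ⟨?_, ?_⟩⟩
  · have h3 := actBy_of_whiskerLeft ρ h1 t (point_whiskerRight_coactionSpec _ t _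
      (scale_eq_comp_chartCoaction t 1 ((g : ℤ) - ℓ)))
    rw [zpow_one] at h3
    exact congr(($h3).left)
  · have h3 := actBy_of_whiskerLeft ρ h2 t (point_whiskerRight_coactionSpec _ t _
      (scale_eq_comp_chartCoaction t (-1) (-(ℓ : ℤ) - 1)))
    rw [zpow_neg_one] at h3
    exact congr(($h3).left)

end Ribbon

end

noncomputable section

namespace Ribbon

open TrivSqZeroExt LaurentPolynomial

variable {k : Type u} [Field k]

/-! ### Homogeneous elements of the overlap -/

/-- The element `y^a (1 + c y^(-s) η)` of the overlap. -/
def homog (s a : ℤ) (c : k) : Overlap k := inl (T a) + inr (C c * T (a - s))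

/-- Since η² = 0, the factors 1 + c y^(-s) η multiply by adding their coefficients. All later
products, powers and transition functions reduce to additions of exponents and coefficients. -/
theorem homog_mul (s a b : ℤ) (c d : k) :
    homog s a c * homog s b d = homog s (a + b) (c + d) := by
  have h1 : (T (a + b - s) : k[T;T⁻¹]) = T (a - s) * T b := by rw [← T_add]; congr 1; ring
  have h2 : (T (a + b - s) : k[T;T⁻¹]) = T a * T (b - s) := by rw [← T_add]; congr 1; ring
  ext1
  · simp only [homog, fst_mul, fst_add, fst_inl, fst_inr, add_zero, T_add]
  · simp only [homog, snd_mul, fst_add, fst_inl, fst_inr, add_zero, snd_add, snd_inl, snd_inr,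
      zero_add, smul_eq_mul, MulOpposite.smul_eq_mul_unop, MulOpposite.unop_op, map_add, add_mul]
    nth_rewrite 1 [h1]
    rw [h2]
    ring

theorem homog_mul_inr (s a b : ℤ) (c : k) :
    homog s a c * inr (T b) = inr (T (a + b)) := by
  ext1
  · simp [homog]
  · simp [homog, -T_mul, T_add, mul_comm]

theorem homog_zero (s : ℤ) : homog s 0 (0 : k) = 1 := by
  simp [homog]

theorem xUnit_monomialF (ℓ : ℕ) :
    (xUnit (monomialF k ℓ) : Overlap k) = homog (ℓ + 1) (-1) (-1) := by
  have h : (T (-2) : k[T;T⁻¹]) * T (-(ℓ : ℤ)) = T (-1 - (ℓ + 1)) := by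
    rw [← T_add]; congr 1; ring
  simp only [xUnit, homog, monomialF, h, map_neg, map_one, neg_mul, one_mul, inr_neg,
    sub_eq_add_neg]

theorem xUnit_inv_monomialF (ℓ : ℕ) :
    (((xUnit (monomialF k ℓ))⁻¹ : (Overlap k)ˣ) : Overlap k) = homog (ℓ + 1) 1 1 := by
  rw [Units.inv_eq_of_mul_eq_one_right]
  rw [xUnit_monomialF, homog_mul]
  simp [homog_zero]

theorem xUnit_zpow_monomialF (ℓ : ℕ) (n : ℤ) :
    ((xUnit (monomialF k ℓ) ^ n : (Overlap k)ˣ) : Overlap k) =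
      homog (ℓ + 1) (-n) (-(n : k)) := by
  induction n using Int.induction_on with
  | zero => simp [homog_zero]
  | succ n ih =>
    rw [zpow_add_one, Units.val_mul, ih, xUnit_monomialF, homog_mul]
    congr 1 <;> push_cast <;> ring
  | pred n ih =>
    rw [zpow_sub_one, Units.val_mul, ih, xUnit_inv_monomialF, homog_mul]
    congr 1 <;> push_cast <;> ring

/-- The shift by `a` comes from x^a = y^(-a) (1 - a y^(-ℓ-1) η), while x^(-e-1) ε becomes y^(-ℓ-1) η
because g = ℓ + e + 1. -/
theorem glue_homog (ℓ e : ℕ) (a : ℤ) (c : k) :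
    glue (ℓ + e + 1) (monomialF k ℓ) (homog (e + 1) a c) = homog (ℓ + 1) (-a) (c - a) := by
  have h : (T (-(a - (e + 1))) : k[T;T⁻¹]) * T (-((ℓ + e + 1 : ℕ) : ℤ) - 1) =
      T (-a - (ℓ + 1)) := by
    rw [← T_add]; congr 1; push_cast; ring
  rw [homog, map_add, glue_T, xUnit_zpow_monomialF, glue_inr, map_mul, invert_C, invert_T,
    mul_assoc, h, homog, homog, add_assoc, ← inr_add, ← add_mul, ← map_add]
  congr 4
  ring

theorem deriv_C_mul_T (c : k) (n : ℤ) : deriv (C c * T n) = C (n * c) * T (n - 1) := by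
  rw [deriv, ← single_eq_C_mul_T, AddMonoidAlgebra.coeff_single, Finsupp.sum_single_index]
  simp

theorem deriv_T (n : ℤ) : deriv (T n : k[T;T⁻¹]) = C (n : k) * T (n - 1) := by
  have := deriv_C_mul_T (1 : k) n
  simpa only [map_one, one_mul, mul_one] using this

theorem transition_monomialF (ℓ e : ℕ) :
    transition (ℓ + e + 1) (monomialF k ℓ) = -homog (ℓ + 1) (ℓ + e) (e : k) := by
  have h : -((T (-2) : k[T;T⁻¹]) * T (-(ℓ : ℤ))) = C (-1 : k) * T (-2 - (ℓ : ℤ)) := by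
    rw [← T_add, map_neg, map_one, neg_one_mul]; rfl
  rw [transition, jacobian, monomialF, h, deriv_C_mul_T, deriv_T, deriv_T, homog, neg_add,
    ← inl_neg, ← inr_neg]
  congr 2
  · have h1 : (T (-1 - 1) : k[T;T⁻¹]) * T (-((ℓ + e + 1 : ℕ) : ℤ) - 1) *
        T (((ℓ + e + 1 : ℕ) : ℤ) + 1) ^ 2 = T (ℓ + e) := by
      rw [T_pow, ← T_add, ← T_add]; congr 1; push_cast; ring
    rw [mul_assoc (C _), mul_assoc (C _), h1]
    simp
  · have h1 : (T (-2 - (ℓ : ℤ) - 1) : k[T;T⁻¹]) * T (-((ℓ + e + 1 : ℕ) : ℤ) - 1) *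
        T (((ℓ + e + 1 : ℕ) : ℤ) + 1) ^ 2 = T (ℓ + e - (ℓ + 1)) := by
      rw [T_pow, ← T_add, ← T_add]; congr 1; push_cast; ring
    have h2 : (T (-2 - (ℓ : ℤ)) : k[T;T⁻¹]) * T (-((ℓ + e + 1 : ℕ) : ℤ) - 1 - 1) *
        T (((ℓ + e + 1 : ℕ) : ℤ) + 1) ^ 2 = T (ℓ + e - (ℓ + 1)) := by
      rw [T_pow, ← T_add, ← T_add]; congr 1; push_cast; ring
    calc _ = C (((-2 - (ℓ : ℤ) : ℤ) : k) * -1) * (T (-2 - (ℓ : ℤ) - 1) *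
          T (-((ℓ + e + 1 : ℕ) : ℤ) - 1) * T (((ℓ + e + 1 : ℕ) : ℤ) + 1) ^ 2) -
          C (-1) * C ((-((ℓ + e + 1 : ℕ) : ℤ) - 1 : ℤ) : k) * (T (-2 - (ℓ : ℤ)) *
          T (-((ℓ + e + 1 : ℕ) : ℤ) - 1 - 1) * T (((ℓ + e + 1 : ℕ) : ℤ) + 1) ^ 2) := by ring
      _ = _ := by
        rw [h1, h2, ← sub_mul, ← map_mul, ← map_sub, ← neg_mul, ← map_neg]
        congr 2
        push_cast
        ring

theorem transition_pow_monomialF (ℓ e n : ℕ) :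
    transition (ℓ + e + 1) (monomialF k ℓ) ^ n =
      (-1 : k) ^ n • homog (ℓ + 1) (n * (ℓ + e)) (n * e : k) := by
  induction n with
  | zero => simp [homog_zero]
  | succ n ih =>
    rw [pow_succ, ih, transition_monomialF, mul_neg, smul_mul_assoc, homog_mul, pow_succ,
      mul_neg_one, neg_smul]
    congr 3 <;> push_cast <;> ring

/-! ### Bases of the spaces of pluricanonical sections -/

/-- The section with first component `x^w (1 + c x^(-e-1) ε)`. -/
def regSection (ℓ e n w : ℕ) (c : k) : Chart k × Chart k :=
  (inl (Polynomial.X ^ w) + inr (Polynomial.C c * Polynomial.X ^ (w - (e + 1))),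
    (-1 : k) ^ n • (inl (Polynomial.X ^ (n * (ℓ + e) - w)) +
      inr (Polynomial.C (n * e - w + c) * Polynomial.X ^ (n * (ℓ + e) - w - (ℓ + 1)))))

/-- The section with first component `x^j ε`. -/
def nilSection (k : Type u) [Field k] (ℓ e n j : ℕ) : Chart k × Chart k :=
  (inr (Polynomial.X ^ j), (-1 : k) ^ n • inr (Polynomial.X ^ (n * (ℓ + e) - (ℓ + e + 2) - j)))

/-- The truncated exponent `w - s` is harmless: either it is a true difference or its coefficient
vanishes. -/
theorem restrict_homog {s w : ℕ} {c : k} (h : c = 0 ∨ s ≤ w) :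
    restrict (inl (Polynomial.X ^ w) + inr (Polynomial.C c * Polynomial.X ^ (w - s))) =
      homog s w c := by
  rw [restrict_eq, homog]
  rcases h with rfl | h
  · simp
  · simp [Nat.cast_sub h]

/-- On the second chart the section is, up to sign, y^(n(ℓ+e)-w) (1 + (ne - w + c) y^(-ℓ-1) η). The
last two hypotheses say that on each chart the nilpotent term is absent or has a non-negative
exponent. -/
theorem regSection_mem {ℓ e n w : ℕ} {c : k} (hw : w ≤ n * (ℓ + e)) (hc : c = 0 ∨ e + 1 ≤ w)
    (hc' : (n * e - w + c : k) = 0 ∨ w + ℓ + 1 ≤ n * (ℓ + e)) :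
    regSection ℓ e n w c ∈ sections (ℓ + e + 1) (monomialF k ℓ) n := by
  change glue _ _ (restrict (inl _ + inr _)) * transition _ _ ^ n = restrict (_ • (inl _ + inr _))
  have hc'' : (n * e - w + c : k) = 0 ∨ ℓ + 1 ≤ n * (ℓ + e) - w := hc'.imp_right (by omega)
  rw [restrict_homog hc, map_smul, restrict_homog hc'']
  have h := glue_homog ℓ e w c
  push_cast at h ⊢
  rw [h, transition_pow_monomialF, mul_smul_comm, homog_mul, Nat.cast_sub hw]
  congr 2
  · push_cast; ring
  · ring

theorem nilSection_mem {ℓ e n j : ℕ} (hj : j + (ℓ + e + 2) ≤ n * (ℓ + e)) :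
    nilSection k ℓ e n j ∈ sections (ℓ + e + 1) (monomialF k ℓ) n := by
  change glue _ _ (restrict (inr _)) * transition _ _ ^ n = restrict (_ • inr _)
  have h : ∀ q : Polynomial k, restrict (inr q) = inr (Polynomial.toLaurent q) := fun q => by
    rw [restrict_eq]; simp
  rw [h, map_smul, h, glue_inr, transition_pow_monomialF, mul_smul_comm, Polynomial.toLaurent_X_pow,
    Polynomial.toLaurent_X_pow, invert_T, ← T_add, mul_comm, homog_mul_inr]
  congr 3
  rw [Nat.cast_sub (by omega), Nat.cast_sub (by omega)]
  push_cast
  ring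

theorem restrict_injective : Function.Injective (restrict (k := k)) := by
  intro z w h
  rw [restrict_eq, restrict_eq] at h
  have h1 := congrArg fst h
  have h2 := congrArg snd h
  simp only [fst_add, fst_inl, fst_inr, add_zero, snd_add, snd_inl, snd_inr, zero_add] at h1 h2
  ext1
  · exact Polynomial.toLaurent_injective h1
  · exact Polynomial.toLaurent_injective h2

/-- A section is determined by its restriction to the first chart. -/
theorem sections_ext {g : ℕ} {f : k[T;T⁻¹]} {n : ℕ} {s t : Chart k × Chart k}
    (hs : s ∈ sections g f n) (ht : t ∈ sections g f n) (h : s.1 = t.1) : s = t := by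
  refine Prod.ext h (restrict_injective ?_)
  change glue g f (restrict s.1) * transition g f ^ n = restrict s.2 at hs
  change glue g f (restrict t.1) * transition g f ^ n = restrict t.2 at ht
  rw [← hs, ← ht, h]

theorem coeff_toLaurent_natCast (p : Polynomial k) (i : ℕ) :
    (Polynomial.toLaurent p).coeff (i : ℤ) = p.coeff i := by
  rw [LaurentPolynomial.coeff_toLaurent]
  exact Finsupp.mapDomain_apply Nat.cast_injective _ _

theorem coeff_toLaurent_of_neg (p : Polynomial k) {i : ℤ} (hi : i < 0) :
    (Polynomial.toLaurent p).coeff i = 0 := by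
  rw [LaurentPolynomial.coeff_toLaurent]
  refine Finsupp.mapDomain_of_notMem_range _ _ ?_
  rintro ⟨j, rfl⟩
  exact absurd hi (by simp)

/-- If `y^D p(y⁻¹)` is a polynomial up to a scalar, then `p` has degree at most `D`. -/
theorem coeff_eq_zero_of_invert_mul_T {D : ℤ} {p q : Polynomial k} {c : k} (hc : c ≠ 0)
    (h : c • (LaurentPolynomial.invert (Polynomial.toLaurent p) * T D) = Polynomial.toLaurent q)
    {w : ℕ} (hw : D < w) : p.coeff w = 0 := by
  have h1 := congrArg (fun r : k[T;T⁻¹] => r.coeff (D - w)) h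
  simp only [coeff_toLaurent_of_neg q (show D - w < 0 by omega)] at h1
  rw [AddMonoidAlgebra.coeff_smul_apply, T, AddMonoidAlgebra.coeff_mul_single_apply, mul_one,
    invert_apply] at h1
  rw [← coeff_toLaurent_natCast]
  simpa [hc] using h1

end Ribbon

end

/-! ### An explicit basis of the pluricanonical sections and their dimension -/

noncomputable section

namespace Ribbon

open TrivSqZeroExt LaurentPolynomial

variable {k : Type u} [Field k]

/-- The index set of the basis of `H⁰(C_ℓ, ω^n)`, for `g = ℓ + e + 1`. -/
abbrev SecIndex (ℓ e n : ℕ) : Type := Fin (n * (ℓ + e) + 1) ⊕ Fin (n * (ℓ + e) - (ℓ + e + 1))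

variable (k) in
/-- The coefficient of `x^(w-e-1) ε` in the basis section with leading term `x^w`. -/
def regCoeff (ℓ e n w : ℕ) : k := if w + ℓ + 1 ≤ n * (ℓ + e) then 0 else w - n * e

/-- A non-zero value requires w ≥ n(ℓ+e) - ℓ. For n ≥ 2 this exceeds e; for n = 1 it leaves only the
borderline w = e, where w - ne is zero. -/
theorem regCoeff_eq_zero_or {ℓ e n w : ℕ} (hn : 1 ≤ n) (he : 1 ≤ e) :
    regCoeff k ℓ e n w = 0 ∨ e + 1 ≤ w := by
  by_cases h : w + ℓ + 1 ≤ n * (ℓ + e)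
  · exact Or.inl (if_pos h)
  · rw [regCoeff, if_neg h]
    obtain rfl | hn2 := hn.eq_or_lt
    · obtain h1 | rfl : e + 1 ≤ w ∨ w = e := by omega
      · exact Or.inr h1
      · exact Or.inl (by simp)
    · have : 2 * (ℓ + e) ≤ n * (ℓ + e) := Nat.mul_le_mul_right _ hn2
      exact Or.inr (by omega)

theorem regCoeff_add_eq_zero_or (ℓ e n w : ℕ) :
    (n * e - w + regCoeff k ℓ e n w : k) = 0 ∨ w + ℓ + 1 ≤ n * (ℓ + e) := by
  by_cases h : w + ℓ + 1 ≤ n * (ℓ + e)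
  · exact Or.inr h
  · rw [regCoeff, if_neg h]
    exact Or.inl (by ring)

/-- The basis sections. -/
def basisSection (ℓ e n : ℕ) : SecIndex ℓ e n → Chart k × Chart k :=
  Sum.elim (fun w => regSection ℓ e n w (regCoeff k ℓ e n w)) (fun j => nilSection k ℓ e n j)

theorem basisSection_mem {ℓ e n : ℕ} (hn : 1 ≤ n) (he : 1 ≤ e) (i : SecIndex ℓ e n) :
    basisSection (k := k) ℓ e n i ∈ sections (ℓ + e + 1) (monomialF k ℓ) n := by
  rcases i with w | j
  · exact regSection_mem (Nat.lt_succ_iff.mp w.2) (regCoeff_eq_zero_or hn he)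
      (regCoeff_add_eq_zero_or _ _ _ _)
  · exact nilSection_mem (by have := j.2; omega)

/-- The coordinates of a section: coefficients of its restriction to the first chart. -/
def sectionCoords (ℓ e n : ℕ) :
    sections (ℓ + e + 1) (monomialF k ℓ) n →ₗ[k] SecIndex ℓ e n → k where
  toFun s := Sum.elim (fun w => s.1.1.fst.coeff w) (fun j => s.1.1.snd.coeff j)
  map_add' s t := by ext (i | i) <;> simp
  map_smul' c s := by ext (i | i) <;> simp

theorem sectionCoords_basisSection {ℓ e n : ℕ} (hn : 1 ≤ n) (he : 1 ≤ e) (i : SecIndex ℓ e n) :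
    sectionCoords ℓ e n ⟨basisSection ℓ e n i, basisSection_mem hn he i⟩ =
      (Pi.single i 1 : SecIndex ℓ e n → k) := by
  rcases i with w | j <;> ext (v | i)
  · simp [sectionCoords, basisSection, regSection, Polynomial.coeff_X_pow, Pi.single_apply,
      Fin.ext_iff]
  · have h : (Polynomial.C (regCoeff k ℓ e n w) * Polynomial.X ^ ((w : ℕ) - (e + 1))).coeff i =
        0 := by
      rw [Polynomial.coeff_C_mul, Polynomial.coeff_X_pow, regCoeff]
      split_ifs with h1 h2
      · simp
      · simp
      -- A non-zero coefficient forces w ≥ n(ℓ+e) - ℓ, which places the exponent w - (e+1) just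
      -- beyond the range of the nilpotent indices.
      · have := i.2
        omega
      · simp
    simpa [sectionCoords, basisSection, regSection] using h
  · simp [sectionCoords, basisSection, nilSection]
  · simp [sectionCoords, basisSection, nilSection, Polynomial.coeff_X_pow, Pi.single_apply,
      Fin.ext_iff]

/-- Regularity on the second chart bounds degrees on the first: the reduced part has degree at most
n(ℓ+e), and when it is zero the nilpotent part has degree at most n(ℓ+e) - (ℓ+e+2). The coordinates
record all these coefficients. -/
theorem sectionCoords_injective (ℓ e n : ℕ) :
    Function.Injective (sectionCoords (k := k) ℓ e n) := by
  rw [injective_iff_map_eq_zero]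
  rintro ⟨s, hs⟩ h
  have hc : ((-1 : k)) ^ n ≠ 0 := pow_ne_zero _ (by simp)
  have hp : ∀ w ≤ n * (ℓ + e), s.1.fst.coeff w = 0 := fun w hw =>
    congrFun h (Sum.inl ⟨w, Nat.lt_succ_iff.mpr hw⟩)
  have hq : ∀ j < n * (ℓ + e) - (ℓ + e + 1), s.1.snd.coeff j = 0 := fun j hj =>
    congrFun h (Sum.inr ⟨j, hj⟩)
  have hs' : glue _ _ (restrict s.1) * transition _ _ ^ n = restrict s.2 := hs
  rw [transition_pow_monomialF, mul_smul_comm] at hs'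
  have hp0 : s.1.fst = 0 := by
    ext w
    by_cases hw : w ≤ n * (ℓ + e)
    · exact hp w hw
    · have h1 := congrArg fst hs'
      rw [restrict_eq s.2, fst_smul, fst_mul, fst_glue, restrict_eq] at h1
      simp only [fst_add, fst_inl, fst_inr, add_zero, homog] at h1
      exact coeff_eq_zero_of_invert_mul_T hc h1 (by zify at hw; omega)
  have h0 : s.1 = inr s.1.snd := by ext1 <;> simp [hp0]
  have hq0 : s.1.snd = 0 := by
    ext j
    by_cases hj : j < n * (ℓ + e) - (ℓ + e + 1)
    · exact hq j hj
    · have h1 := congrArg snd hs'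
      have h2 : restrict s.1 = inr (Polynomial.toLaurent s.1.snd) := by
        rw [restrict_eq, hp0]; simp
      rw [h2, glue_inr, restrict_eq s.2, snd_smul, snd_mul] at h1
      simp only [snd_add, fst_inr, snd_inl, snd_inr, zero_add, smul_eq_mul, zero_mul, homog,
        fst_add, fst_inl, add_zero, MulOpposite.smul_eq_mul_unop, MulOpposite.unop_op, mul_assoc,
        ← T_add] at h1
      refine coeff_eq_zero_of_invert_mul_T hc h1 (w := j) ?_
      have hj' : n * (ℓ + e) < j + (ℓ + e + 2) := by omega
      zify at hj'
      push_cast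
      linarith
  refine Subtype.ext (sections_ext hs (Submodule.zero_mem _) ?_)
  rw [h0, hq0, inr_zero]
  rfl

theorem sectionCoords_bijective {ℓ e n : ℕ} (hn : 1 ≤ n) (he : 1 ≤ e) :
    Function.Bijective (sectionCoords (k := k) ℓ e n) := by
  refine ⟨sectionCoords_injective ℓ e n, fun a => ?_⟩
  refine ⟨∑ i, a i • ⟨basisSection ℓ e n i, basisSection_mem hn he i⟩, ?_⟩
  rw [map_sum]
  simp only [map_smul, sectionCoords_basisSection hn he]
  ext i
  simp [Finset.sum_apply, Pi.single_apply]

/-- The basis of the space of `n`-canonical sections. -/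
def sectionBasis {ℓ e n : ℕ} (hn : 1 ≤ n) (he : 1 ≤ e) :
    Module.Basis (SecIndex ℓ e n) k (sections (ℓ + e + 1) (monomialF k ℓ) n) :=
  Module.Basis.ofEquivFun (LinearEquiv.ofBijective _ (sectionCoords_bijective hn he))

theorem sectionBasis_apply {ℓ e n : ℕ} (hn : 1 ≤ n) (he : 1 ≤ e) (i : SecIndex ℓ e n) :
    (sectionBasis (k := k) hn he i : Chart k × Chart k) = basisSection ℓ e n i := by
  have h : sectionBasis (k := k) hn he i = ⟨basisSection ℓ e n i, basisSection_mem hn he i⟩ := by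
    apply sectionCoords_injective
    rw [sectionCoords_basisSection hn he]
    rw [sectionBasis, Module.Basis.coe_ofEquivFun]
    exact LinearEquiv.apply_symm_apply (LinearEquiv.ofBijective _ (sectionCoords_bijective hn he)) _
  rw [h]

theorem card_secIndex {ℓ e n : ℕ} (hn : 1 ≤ n) (he : 1 ≤ e) :
    Fintype.card (SecIndex ℓ e n) =
      if n = 1 then ℓ + e + 1 else (2 * n - 1) * (ℓ + e + 1 - 1) := by
  rw [Fintype.card_sum, Fintype.card_fin, Fintype.card_fin]
  split_ifs with h
  · subst h; omega
  · obtain ⟨n, rfl⟩ : ∃ m, n = m + 2 := ⟨n - 2, by omega⟩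
    have h1 : ℓ + e + 1 ≤ (n + 2) * (ℓ + e) := by nlinarith
    zify [h1, show 1 ≤ 2 * (n + 2) by omega, show 1 ≤ ℓ + e + 1 by omega]
    ring

end Ribbon

end

noncomputable section

namespace Ribbon

open TrivSqZeroExt LaurentPolynomial GIT

variable {k : Type u} [Field k]

/-! ### Projective normality -/

theorem regSection_mul {ℓ e n m w v : ℕ} {c d : k} (hw : w ≤ n * (ℓ + e)) (hv : v ≤ m * (ℓ + e))
    (hc : c = 0 ∨ e + 1 ≤ w) (hd : d = 0 ∨ e + 1 ≤ v)
    (hc' : (n * e - w + c : k) = 0 ∨ w + ℓ + 1 ≤ n * (ℓ + e))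
    (hd' : (m * e - v + d : k) = 0 ∨ v + ℓ + 1 ≤ m * (ℓ + e)) :
    regSection ℓ e n w c * regSection ℓ e m v d = regSection ℓ e (n + m) (w + v) (c + d) := by
  have hcd : c + d = 0 ∨ e + 1 ≤ w + v := by
    rcases hc with rfl | hc
    · rcases hd with rfl | hd
      · exact Or.inl (add_zero 0)
      · exact Or.inr (by omega)
    · exact Or.inr (by omega)
  have hD : (n + m) * (ℓ + e) = n * (ℓ + e) + m * (ℓ + e) := add_mul _ _ _
  refine sections_ext (mul_mem_sections (regSection_mem hw hc hc') (regSection_mem hv hd hd'))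
    (regSection_mem (by omega) hcd ?_) ?_
  · rcases hc' with hc' | hc'
    · rcases hd' with hd' | hd'
      · left
        push_cast
        linear_combination hc' + hd'
      · right; omega
    · right; omega
  · apply restrict_injective
    change restrict ((inl _ + inr _) * (inl _ + inr _)) = restrict (inl _ + inr _)
    rw [map_mul, restrict_homog hc, restrict_homog hd, restrict_homog hcd, homog_mul]
    push_cast
    rfl

/-- This is how nilpotent sections arise from products of non-nilpotent ones: two products with the
same exponent whose coefficients differ by one. -/
theorem regSection_add_one_sub (ℓ e n j : ℕ) (c : k) :
    regSection ℓ e n (j + (e + 1)) (c + 1) - regSection ℓ e n (j + (e + 1)) c =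
      nilSection k ℓ e n j := by
  have h : n * (ℓ + e) - (j + (e + 1)) - (ℓ + 1) = n * (ℓ + e) - (ℓ + e + 2) - j := by omega
  refine Prod.ext ?_ ?_
  · change (inl _ + inr _) - (inl _ + inr _) = inr _
    rw [add_sub_add_left_eq_sub, ← inr_sub, ← sub_mul, ← map_sub, add_sub_cancel_left, map_one,
      one_mul, Nat.add_sub_cancel]
  · change _ • (inl _ + inr _) - _ • (inl _ + inr _) = _ • inr _
    rw [← smul_sub, add_sub_add_left_eq_sub, ← inr_sub, ← sub_mul, ← map_sub, h]
    congr 2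
    rw [← add_assoc, add_sub_cancel_left, map_one, one_mul]

theorem regSection_sub (ℓ e n j : ℕ) (c d : k) :
    regSection ℓ e n (j + (e + 1)) d - regSection ℓ e n (j + (e + 1)) c =
      (d - c) • nilSection k ℓ e n j := by
  have h : n * (ℓ + e) - (j + (e + 1)) - (ℓ + 1) = n * (ℓ + e) - (ℓ + e + 2) - j := by omega
  refine Prod.ext ?_ ?_
  · change (inl _ + inr _) - (inl _ + inr _) = _ • inr _
    rw [add_sub_add_left_eq_sub, ← inr_sub, ← sub_mul, ← map_sub, Nat.add_sub_cancel, ← inr_smul,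
      Polynomial.smul_eq_C_mul]
  · change _ • (inl _ + inr _) - _ • (inl _ + inr _) = _ • _ • inr _
    rw [← smul_sub, add_sub_add_left_eq_sub, ← inr_sub, ← sub_mul, ← map_sub, h,
      smul_comm (d - c), ← inr_smul _ (d - c), Polynomial.smul_eq_C_mul]
    congr 4
    ring

variable {ℓ e n : ℕ}

theorem regSection_mem_mul (hn : 1 ≤ n) (he : 1 ≤ e) {w v : ℕ} (hw : w ≤ n * (ℓ + e))
    (hv : v ≤ ℓ + e) :
    regSection ℓ e (n + 1) (w + v) (regCoeff k ℓ e n w + regCoeff k ℓ e 1 v) ∈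
      sections (ℓ + e + 1) (monomialF k ℓ) n * sections (ℓ + e + 1) (monomialF k ℓ) 1 := by
  have hv' : v ≤ 1 * (ℓ + e) := by omega
  rw [← regSection_mul hw hv' (regCoeff_eq_zero_or hn he) (regCoeff_eq_zero_or le_rfl he)
    (regCoeff_add_eq_zero_or _ _ _ _) (regCoeff_add_eq_zero_or _ _ _ _)]
  exact Submodule.mul_mem_mul
    (regSection_mem hw (regCoeff_eq_zero_or hn he) (regCoeff_add_eq_zero_or _ _ _ _))
    (regSection_mem hv' (regCoeff_eq_zero_or le_rfl he) (regCoeff_add_eq_zero_or _ _ _ _))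

theorem regCoeff_one_of_le {v : ℕ} (hv : v ≤ e) : regCoeff k ℓ e 1 v = 0 := by
  rw [regCoeff]
  split_ifs with h
  · rfl
  · obtain rfl : v = e := by omega
    simp

theorem regCoeff_one_of_ge {v : ℕ} (hv : e ≤ v) : regCoeff k ℓ e 1 v = v - e := by
  rw [regCoeff, if_neg (by omega)]
  simp

/-- For n = 1 the basis of H⁰(ω) has no nilpotent sections, and its coefficients are max(v - e, 0).
This function bends at v = e, so two decompositions of j + e + 1, one using e and the other moved by
one step across e, have coefficient sums differing by exactly 1. For n ≥ 2 a factor x^v + … can be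
split off from x^j ε. -/
theorem nilSection_mem_mul (hℓ : 1 ≤ ℓ) (he : 1 ≤ e) (hn : 1 ≤ n) {j : ℕ}
    (hj : j + (ℓ + e + 2) ≤ (n + 1) * (ℓ + e)) :
    nilSection k ℓ e (n + 1) j ∈
      sections (ℓ + e + 1) (monomialF k ℓ) n * sections (ℓ + e + 1) (monomialF k ℓ) 1 := by
  obtain rfl | hn2 := hn.eq_or_lt
  · have key : ∀ (w v w' v' : ℕ) (c : k), w ≤ ℓ + e → v ≤ ℓ + e → w' ≤ ℓ + e → v' ≤ ℓ + e →
        w + v = j + (e + 1) → w' + v' = j + (e + 1) →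
        regCoeff k ℓ e 1 w + regCoeff k ℓ e 1 v = c →
        regCoeff k ℓ e 1 w' + regCoeff k ℓ e 1 v' = c + 1 →
        nilSection k ℓ e (1 + 1) j ∈ sections (ℓ + e + 1) (monomialF k ℓ) 1 *
          sections (ℓ + e + 1) (monomialF k ℓ) 1 := by
      intro w v w' v' c hw hv hw' hv' h1 h2 h3 h4
      have m1 := regSection_mem_mul (k := k) (ℓ := ℓ) le_rfl he (hw.trans (one_mul _).ge) hv
      have m2 := regSection_mem_mul (k := k) (ℓ := ℓ) le_rfl he (hw'.trans (one_mul _).ge) hv'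
      rw [h1, h3] at m1
      rw [h2, h4] at m2
      rw [← regSection_add_one_sub ℓ e (1 + 1) j c]
      exact Submodule.sub_mem _ m2 m1
    by_cases hu : j + 1 ≤ e
    · refine key e (j + 1) (e + 1) j 0 (by omega) (by omega) (by omega) (by omega) (by omega)
        (by omega) ?_ ?_
      · rw [regCoeff_one_of_le le_rfl, regCoeff_one_of_le hu, add_zero]
      · rw [regCoeff_one_of_ge (by omega), regCoeff_one_of_le (by omega)]
        push_cast
        ring
    · refine key e (j + 1) (e - 1) (j + 2) (j + 1 - e) (by omega) (by omega) (by omega) (by omega)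
        (by omega) (by omega) ?_ ?_
      · rw [regCoeff_one_of_le le_rfl, regCoeff_one_of_ge (by omega)]
        push_cast
        ring
      · rw [regCoeff_one_of_le (by omega), regCoeff_one_of_ge (by omega)]
        push_cast
        ring
  · have h2 : 2 * (ℓ + e) ≤ n * (ℓ + e) := Nat.mul_le_mul_right _ hn2
    have h3 : (n + 1) * (ℓ + e) = n * (ℓ + e) + (ℓ + e) := by ring
    obtain ⟨i, v, rfl, hi, hv⟩ : ∃ i v, j = i + v ∧ i + (ℓ + e + 2) ≤ n * (ℓ + e) ∧ v ≤ ℓ + e := by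
      by_cases hj' : j + (ℓ + e + 2) ≤ n * (ℓ + e)
      · exact ⟨j, 0, rfl, hj', Nat.zero_le _⟩
      · exact ⟨n * (ℓ + e) - (ℓ + e + 2), j - (n * (ℓ + e) - (ℓ + e + 2)), by omega, by omega,
          by omega⟩
    have hv' : v ≤ 1 * (ℓ + e) := by omega
    have hr : regSection ℓ e 1 v (regCoeff k ℓ e 1 v) ∈ sections (ℓ + e + 1) (monomialF k ℓ) 1 :=
      regSection_mem hv' (regCoeff_eq_zero_or le_rfl he) (regCoeff_add_eq_zero_or _ _ _ _)
    have hi' := nilSection_mem (k := k) hi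
    have h : nilSection k ℓ e (n + 1) (i + v) = nilSection k ℓ e n i *
        regSection ℓ e 1 v (regCoeff k ℓ e 1 v) := by
      refine sections_ext (nilSection_mem hj) (mul_mem_sections hi' hr) ?_
      change inr _ = inr _ * (inl _ + inr _)
      rw [mul_add, inr_mul_inr, add_zero, inr_mul_inl, MulOpposite.smul_eq_mul_unop,
        MulOpposite.unop_op, pow_add]
    rw [h]
    exact Submodule.mul_mem_mul hi' hr

/-- A product of two basis sections with the right leading term can differ from the wanted one only
by a multiple of a nilpotent section, which is already known to be in the product space. -/
theorem sections_succ_le (hℓ : 1 ≤ ℓ) (he : 1 ≤ e) (hn : 1 ≤ n) :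
    sections (ℓ + e + 1) (monomialF k ℓ) (n + 1) ≤
      sections (ℓ + e + 1) (monomialF k ℓ) n * sections (ℓ + e + 1) (monomialF k ℓ) 1 := by
  have hmem : ∀ i : SecIndex ℓ e (n + 1), basisSection (k := k) ℓ e (n + 1) i ∈
      sections (ℓ + e + 1) (monomialF k ℓ) n * sections (ℓ + e + 1) (monomialF k ℓ) 1 := by
    rintro (⟨u, hu⟩ | ⟨j, hj⟩)
    · have h3 : (n + 1) * (ℓ + e) = n * (ℓ + e) + (ℓ + e) := by ring
      obtain ⟨w, v, rfl, hw, hv⟩ : ∃ w v, u = w + v ∧ w ≤ n * (ℓ + e) ∧ v ≤ ℓ + e :=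
        ⟨min u (n * (ℓ + e)), u - min u (n * (ℓ + e)), by omega, by omega, by omega⟩
      have h := regSection_mem_mul (k := k) hn he hw hv
      set c := regCoeff k ℓ e n w + regCoeff k ℓ e 1 v with hc
      change regSection ℓ e (n + 1) (w + v) (regCoeff k ℓ e (n + 1) (w + v)) ∈ _
      by_cases hcc : regCoeff k ℓ e (n + 1) (w + v) = c
      · rwa [hcc]
      -- This bound and the next ensure that the nilpotent section needed for the correction exists.
      -- If either fails, the two coefficients already agree: near the top all three follow the
      -- linear formula, and for w + v ≤ e all three are zero.
      have h4 : w + v + ℓ + 1 ≤ (n + 1) * (ℓ + e) := by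
        by_contra h4
        apply hcc
        rw [hc, regCoeff, if_neg h4, regCoeff, if_neg (by omega), regCoeff, if_neg (by omega)]
        push_cast
        ring
      have h5 : e + 1 ≤ w + v := by
        have h6 : regCoeff k ℓ e (n + 1) (w + v) = 0 := if_pos h4
        by_contra h5
        apply hcc
        rw [h6, hc, (regCoeff_eq_zero_or hn he).resolve_right (by omega),
          regCoeff_one_of_le (by omega), add_zero]
      obtain ⟨j, hj⟩ : ∃ j, w + v = j + (e + 1) := ⟨w + v - (e + 1), by omega⟩
      have h7 := nilSection_mem_mul (k := k) hℓ he hn (j := j) (by omega)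
      have h8 := regSection_sub (k := k) ℓ e (n + 1) j c (regCoeff k ℓ e (n + 1) (w + v))
      rw [← hj, sub_eq_iff_eq_add] at h8
      rw [h8]
      exact Submodule.add_mem _ (Submodule.smul_mem _ _ h7) h
    · exact nilSection_mem_mul hℓ he hn (by omega)
  intro s hs
  have h := (sectionBasis (k := k) (ℓ := ℓ) (Nat.le_add_left 1 n) he).sum_repr ⟨s, hs⟩
  have h' := congrArg Subtype.val h
  rw [Submodule.coe_sum] at h'
  simp only [Submodule.coe_smul, sectionBasis_apply] at h'
  rw [← h']
  exact Submodule.sum_mem _ fun i _ => Submodule.smul_mem _ _ (hmem i)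

theorem sections_le_pow (hℓ : 1 ≤ ℓ) (he : 1 ≤ e) (hn : 1 ≤ n) :
    sections (ℓ + e + 1) (monomialF k ℓ) n ≤ sections (ℓ + e + 1) (monomialF k ℓ) 1 ^ n := by
  induction n, hn using Nat.le_induction with
  | base => rw [Submodule.pow_one]
  | succ n hn ih =>
    rw [Submodule.pow_succ]
    exact (sections_succ_le hℓ he hn).trans (mul_le_mul_left ih _)

theorem pow_le_sections (g : ℕ) (f : k[T;T⁻¹]) (n : ℕ) : sections g f 1 ^ n ≤ sections g f n := by
  induction n with
  | zero =>
    rw [Submodule.pow_zero, Submodule.one_le]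
    change glue g f (restrict 1) * transition g f ^ 0 = restrict 1
    simp
  | succ n ih =>
    rw [Submodule.pow_succ, Submodule.mul_le]
    exact fun s hs t ht => mul_mem_sections (ih hs) ht

/-- Generation by sections of ω suffices: H⁰(ω^(nm)) ⊆ H⁰(ω)^(nm) = (H⁰(ω)^n)^m ⊆ H⁰(ω^n)^m. -/
theorem restrictSym_surjective (hℓ : 1 ≤ ℓ) (he : 1 ≤ e) (hn : 1 ≤ n) {m : ℕ} (hm : 1 ≤ m) :
    Function.Surjective (restrictSym (ℓ + e + 1) (monomialF k ℓ) n m) := by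
  rintro ⟨s, hs⟩
  have h1 : s ∈ sections (ℓ + e + 1) (monomialF k ℓ) n ^ m := by
    have h2 := sections_le_pow hℓ he (Nat.mul_pos hn hm) hs
    have h3 : sections (ℓ + e + 1) (monomialF k ℓ) 1 ^ (n * m) =
        (sections (ℓ + e + 1) (monomialF k ℓ) 1 ^ n) ^ m :=
      pow_mul (M := Submodule k (Chart k × Chart k)) _ _ _
    have h4 : (sections (ℓ + e + 1) (monomialF k ℓ) 1 ^ n) ^ m ≤
        sections (ℓ + e + 1) (monomialF k ℓ) n ^ m :=
      pow_le_pow_left' (pow_le_sections (ℓ + e + 1) (monomialF k ℓ) n) m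
    rw [h3] at h2
    exact h4 h2
  have e1 : (SymmetricAlgebra.lift (sections (ℓ + e + 1) (monomialF k ℓ) n).subtype).toLinearMap ∘ₗ
      SymmetricAlgebra.ι k _ = (sections (ℓ + e + 1) (monomialF k ℓ) n).subtype :=
    SymmetricAlgebra.lift_comp_ι _
  rw [← Submodule.range_subtype (sections (ℓ + e + 1) (monomialF k ℓ) n), ← e1,
    LinearMap.range_comp, ← Submodule.map_pow] at h1
  obtain ⟨z, hz, rfl⟩ := h1
  exact ⟨⟨z, hz⟩, rfl⟩

/-- Evaluated on preimages of the basis `b`, the form takes the value 1. -/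
theorem hilbertPoint_ne_zero (hℓ : 1 ≤ ℓ) (he : 1 ≤ e) (hn : 1 ≤ n) {m : ℕ} (hm : 1 ≤ m) (b) :
    hilbertPoint (ℓ + e + 1) (monomialF k ℓ) n m b ≠ 0 := by
  choose z hz using fun i => restrictSym_surjective (k := k) hℓ he hn hm (b i)
  intro h
  have h1 := DFunLike.congr_fun h z
  rw [hilbertPoint, AlternatingMap.compLinearMap_apply] at h1
  have h2 : (fun i => restrictSym (ℓ + e + 1) (monomialF k ℓ) n m (z i)) = b := funext hz
  rw [h2, b.det_self] at h1
  exact one_ne_zero h1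

end Ribbon

end

noncomputable section

namespace GIT

open Module

/-! ### Diagonal maps and diagonal one-parameter subgroups -/

section Diagonal

variable {k V ι : Type*} [Field k] [AddCommGroup V] [Module k V] [Fintype ι] [DecidableEq ι]
  (b : Basis ι k V)

/-- The endomorphism which is diagonal in the basis `b`, with eigenvalues `u`. -/
def diagMap (u : ι → k) : V →ₗ[k] V := Matrix.toLin b b (Matrix.diagonal u)

theorem diagMap_basis (u : ι → k) (i : ι) : diagMap b u (b i) = u i • b i := by
  rw [diagMap, Matrix.toLin_self, Finset.sum_eq_single i]
  · rw [Matrix.diagonal_apply_eq]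
  · intro j _ hj
    rw [Matrix.diagonal_apply_ne _ hj, zero_smul]
  · exact fun h => absurd (Finset.mem_univ i) h

theorem det_diagMap (u : ι → k) : LinearMap.det (diagMap b u) = ∏ i, u i := by
  rw [diagMap, LinearMap.det_toLin, Matrix.det_diagonal]

theorem diagMap_comp (u v : ι → k) : diagMap b u ∘ₗ diagMap b v = diagMap b (u * v) :=
  b.ext fun i => by
    rw [LinearMap.comp_apply, diagMap_basis, diagMap_basis, map_smul, diagMap_basis, smul_smul,
      mul_comm, Pi.mul_apply]

theorem diagMap_one : diagMap b 1 = LinearMap.id :=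
  b.ext fun i => by rw [diagMap_basis, Pi.one_apply, one_smul, LinearMap.id_apply]

/-- The automorphism which is diagonal in the basis `b`, with eigenvalues `u`. -/
def diagEquiv (u : ι → kˣ) : V ≃ₗ[k] V :=
  LinearEquiv.ofLinearMap (diagMap b fun i => (u i : k)) (diagMap b fun i => ((u i)⁻¹ : kˣ))
    (by
      rw [diagMap_comp, ← diagMap_one b]
      congr 1
      ext i
      exact (u i).mul_inv)
    (by
      rw [diagMap_comp, ← diagMap_one b]
      congr 1
      ext i
      exact (u i).inv_mul)

theorem det_diagEquiv (u : ι → kˣ) : (diagEquiv b u).det = ∏ i, u i := by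
  rw [← Units.val_inj, LinearEquiv.coe_det, Units.coe_prod, ← det_diagMap b]
  rfl

theorem diagEquiv_one : diagEquiv b 1 = 1 :=
  LinearEquiv.toLinearMap_injective (diagMap_one b)

theorem diagEquiv_mul (u v : ι → kˣ) : diagEquiv b (u * v) = diagEquiv b u * diagEquiv b v :=
  LinearEquiv.toLinearMap_injective (diagMap_comp b _ _).symm

/-- The diagonal one-parameter subgroup of `SL(V)` with weights `wt` on the basis `b`. -/
def diagSubgroup (wt : ι → ℤ) (h : ∑ i, wt i = 0) : kˣ →* SpecialLinearGroup k V where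
  toFun t := ⟨diagEquiv b fun i => t ^ wt i, by
    have h1 : ∏ i, t ^ wt i = t ^ ∑ i, wt i :=
      (map_sum (zmultiplesHom (Additive kˣ) (Additive.ofMul t)) wt Finset.univ).symm
    rw [det_diagEquiv, h1, h, zpow_zero]⟩
  map_one' := Subtype.ext <| by
    simp only [one_zpow]
    exact diagEquiv_one b
  map_mul' s t := Subtype.ext <| by
    simp only [mul_zpow]
    exact diagEquiv_mul b _ _

end Diagonal

/-! ### Symmetric powers -/

section SymPow

variable {k V A : Type*} [Field k] [AddCommGroup V] [Module k V] [CommRing A] [Algebra k A]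

theorem symPowLift_symPowMap (φ : V →ₗ[k] A) (ψ : V →ₗ[k] V) (m : ℕ) (z : symPow k V m) :
    symPowLift φ m (symPowMap ψ m z) = symPowLift (φ ∘ₗ ψ) m z := by
  have h : (SymmetricAlgebra.lift φ).comp
      (SymmetricAlgebra.lift (SymmetricAlgebra.ι k V ∘ₗ ψ)) =
        SymmetricAlgebra.lift (φ ∘ₗ ψ) := by
    apply SymmetricAlgebra.algHom_ext
    ext v
    simp
  exact DFunLike.congr_fun h (z : SymmetricAlgebra k V)

/-- Induction on elements of the symmetric powers. -/
theorem symPow_induction {C : ℕ → SymmetricAlgebra k V → Prop}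
    (algebraMap : ∀ r : k, C 0 (algebraMap k _ r))
    (add : ∀ i x y, C i x → C i y → C i (x + y))
    (mul : ∀ v i x, C i x → C (i + 1) (SymmetricAlgebra.ι k V v * x)) {m : ℕ}
    (z : symPow k V m) : C m z :=
  Submodule.pow_induction_on_left' (C := fun n x _ => C n x)
    _ algebraMap (fun x y i _ _ => add i x y)
    (fun m hm i x _ hx => by obtain ⟨v, rfl⟩ := hm; exact mul v i x hx) z.2

/-- Used for a linearized automorphism: pullback of functions is `Φ`, and the factor `a` comes from
the line bundle, hence enters once per factor of a monomial. -/
theorem symPowLift_eq_pow_mul {φ ψ : V →ₗ[k] A} (Φ : A →ₐ[k] A) (a : A)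
    (h : ∀ v, ψ v = a * Φ (φ v)) (m : ℕ) (z : symPow k V m) :
    symPowLift ψ m z = a ^ m * Φ (symPowLift φ m z) := by
  change SymmetricAlgebra.lift ψ z = a ^ m * Φ (SymmetricAlgebra.lift φ z)
  refine symPow_induction (C := fun m z => SymmetricAlgebra.lift ψ z =
    a ^ m * Φ (SymmetricAlgebra.lift φ z)) (fun r => by simp) (fun i x y hx hy => ?_)
    (fun v i x hx => ?_) z
  · rw [map_add, map_add, map_add, hx, hy, mul_add]
  · rw [map_mul, map_mul, map_mul, hx, SymmetricAlgebra.lift_ι_apply,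
      SymmetricAlgebra.lift_ι_apply, h]
    ring

theorem symPowLift_smul (c : k) (φ : V →ₗ[k] A) (m : ℕ) (z : symPow k V m) :
    symPowLift (c • φ) m z = c ^ m • symPowLift φ m z := by
  rw [symPowLift_eq_pow_mul (AlgHom.id k A) (algebraMap k A c) (φ := φ), ← map_pow,
    Algebra.smul_def]
  · rfl
  · intro v
    rw [LinearMap.smul_apply, Algebra.smul_def]
    rfl

/-- If `φ₁` takes values in an ideal of square zero, the map of symmetric powers induced by
`φ₀ + s φ₁` is affine in `s`. -/
theorem symPowLift_add_smul {φ₀ φ₁ : V →ₗ[k] A} {I : Ideal A} (hI : ∀ x ∈ I, ∀ y ∈ I, x * y = 0)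
    (h : ∀ v, φ₁ v ∈ I) (m : ℕ) (z : symPow k V m) :
    symPowLift (φ₀ + φ₁) m z - symPowLift φ₀ m z ∈ I ∧ ∀ s : k, symPowLift (φ₀ + s • φ₁) m z =
      symPowLift φ₀ m z + s • (symPowLift (φ₀ + φ₁) m z - symPowLift φ₀ m z) := by
  change SymmetricAlgebra.lift (φ₀ + φ₁) z - SymmetricAlgebra.lift φ₀ z ∈ I ∧ ∀ s : k,
    SymmetricAlgebra.lift (φ₀ + s • φ₁) z = SymmetricAlgebra.lift φ₀ z +
      s • (SymmetricAlgebra.lift (φ₀ + φ₁) z - SymmetricAlgebra.lift φ₀ z)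
  refine symPow_induction (C := fun _ z =>
    SymmetricAlgebra.lift (φ₀ + φ₁) z - SymmetricAlgebra.lift φ₀ z ∈ I ∧ ∀ s : k,
      SymmetricAlgebra.lift (φ₀ + s • φ₁) z = SymmetricAlgebra.lift φ₀ z +
        s • (SymmetricAlgebra.lift (φ₀ + φ₁) z - SymmetricAlgebra.lift φ₀ z))
    (fun r => by simp) (fun i x y hx hy => ?_) (fun v i x hx => ?_) z
  · refine ⟨?_, fun s => ?_⟩
    · convert I.add_mem hx.1 hy.1 using 1
      simp only [map_add]
      ring
    · simp only [map_add, hx.2 s, hy.2 s, smul_add, smul_sub]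
      ring
  · obtain ⟨h1, h2⟩ := hx
    obtain ⟨δ, hδ⟩ : ∃ δ, SymmetricAlgebra.lift (φ₀ + φ₁) x - SymmetricAlgebra.lift φ₀ x = δ :=
      ⟨_, rfl⟩
    rw [hδ] at h1 h2
    -- The product of two increments in `I` vanishes; this removes the term quadratic in `s`.
    have h0 := hI _ (h v) _ h1
    simp only [map_mul, SymmetricAlgebra.lift_ι_apply, LinearMap.add_apply, LinearMap.smul_apply,
      h2, sub_eq_iff_eq_add'.mp hδ]
    have e1 : (φ₀ v + φ₁ v) * (SymmetricAlgebra.lift φ₀ x + δ) -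
        φ₀ v * SymmetricAlgebra.lift φ₀ x =
          φ₀ v * δ + φ₁ v * SymmetricAlgebra.lift φ₀ x := by
      linear_combination h0
    rw [e1]
    refine ⟨I.add_mem (I.mul_mem_left _ h1) (I.mul_mem_right _ (h v)), fun s => ?_⟩
    simp only [Algebra.smul_def]
    linear_combination (algebraMap k A s) ^ 2 * h0

end SymPow

/-! ### Alternating forms -/

theorem det_compLinearMap_comp {k M W ι : Type*} [Field k] [AddCommGroup M] [Module k M]
    [AddCommGroup W] [Module k W] [Fintype ι] [DecidableEq ι] (b : Basis ι k W) (T : W →ₗ[k] W)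
    (f : M →ₗ[k] W) :
    b.det.compLinearMap (T ∘ₗ f) = LinearMap.det T • b.det.compLinearMap f := by
  ext z
  exact b.det_comp T fun i => f (z i)

/-- A form pulled back by `A + r B` depends polynomially on `r`. -/
theorem exists_compLinearMap_add_smul {k M W : Type*} [Field k] [CharZero k] [AddCommGroup M]
    [Module k M] [AddCommGroup W] [Module k W] {P : ℕ} (φ : W [⋀^Fin P]→ₗ[k] k)
    (A B : M →ₗ[k] W) :
    ∃ (p : Fin (P + 1) → Polynomial k) (y : Fin (P + 1) → M [⋀^Fin P]→ₗ[k] k), ∀ r : k,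
      φ.compLinearMap (A + r • B) = ∑ i, (p i).eval r • y i := by
  -- The values are polynomial in `r` of degree at most `P`, so interpolation at 0, …, P, distinct
  -- in characteristic zero, gives coefficient polynomials independent of the argument of the form.
  have hv : Set.InjOn (fun i : Fin (P + 1) => ((i : ℕ) : k)) (Finset.univ : Finset (Fin (P + 1))) :=
    fun i _ j _ h => Fin.ext (Nat.cast_injective h)
  refine ⟨Lagrange.basis Finset.univ fun i => ((i : ℕ) : k),
    fun i => φ.compLinearMap (A + ((i : ℕ) : k) • B), fun r => ?_⟩
  ext z
  -- Multilinear expansion: `s` is the set of slots filled by `A`, and each remaining slot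
  -- contributes a factor `r`.
  let Q : Polynomial k := ∑ s : Finset (Fin P),
    Polynomial.monomial sᶜ.card (φ (s.piecewise (fun j => A (z j)) fun j => B (z j)))
  have hQ : ∀ r : k, Q.eval r = φ.compLinearMap (A + r • B) z := by
    intro r
    have h := φ.toMultilinearMap.map_add_univ (fun j => A (z j)) (fun j => r • B (z j))
    refine Eq.trans ?_ h.symm
    rw [Polynomial.eval_finsetSum]
    refine Finset.sum_congr rfl fun s _ => ?_
    have h1 := φ.toMultilinearMap.map_piecewise_smul (fun _ => r)
      (s.piecewise (fun j => A (z j)) fun j => B (z j)) sᶜ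
    rw [Finset.prod_const, smul_eq_mul, mul_comm] at h1
    rw [Polynomial.eval_monomial]
    refine h1.symm.trans (congrArg _ (funext fun j => ?_))
    by_cases hj : j ∈ s <;> simp [hj]
  have hdeg : Q.degree < (Finset.univ : Finset (Fin (P + 1))).card := by
    rw [Finset.card_univ, Fintype.card_fin]
    refine (Polynomial.degree_sum_le _ _).trans_lt ((Finset.sup_lt_iff (WithBot.bot_lt_coe _)).mpr
      fun s _ => (Polynomial.degree_monomial_le _ _).trans_lt ?_)
    have := sᶜ.card_le_univ
    rw [Fintype.card_fin] at this
    exact_mod_cast Nat.lt_succ_of_le this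
  have h := congrArg (Polynomial.eval r) (Lagrange.eq_interpolate hv hdeg)
  rw [hQ, Lagrange.interpolate_apply, Polynomial.eval_finsetSum] at h
  let ev : (M [⋀^Fin P]→ₗ[k] k) →+ k := ⟨⟨fun f => f z, rfl⟩, fun _ _ => rfl⟩
  rw [h]
  refine Eq.trans ?_ (map_sum ev _ _).symm
  refine Finset.sum_congr rfl fun i _ => ?_
  rw [Polynomial.eval_mul, Polynomial.eval_C, hQ, mul_comm]
  rfl

/-! ### A numerical criterion -/

section Criterion

variable {k G W : Type*} [Field k] [CharZero k] [Group G] [AddCommGroup W] [Module k W]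

/-- If `γ t · x` is a polynomial in `t` that vanishes at `0`, then `x` is not semistable. -/
theorem not_isSemistable_of_forall_eq_sum {ι : Type*} [Fintype ι] (ρ : Representation k G W)
    (x : W) (γ : kˣ → G) (p : ι → Polynomial k) (y : ι → W) (hp : ∀ i, (p i).eval 0 = 0)
    (h : ∀ t : kˣ, ρ (γ t) x = ∑ i, (p i).eval (t : k) • y i) : ¬ IsSemistable ρ x := by
  rintro ⟨d, F, hd, hF, hx⟩
  let Q : Polynomial k := ∑ r : Fin d → ι, Polynomial.C (F fun j => y (r j)) * ∏ j, p (r j)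
  have hQ : ∀ t : kˣ, Q.eval (t : k) = F fun _ => x := by
    intro t
    rw [← hF (γ t) x, h t, F.map_sum, Polynomial.eval_finsetSum]
    refine Finset.sum_congr rfl fun r _ => ?_
    rw [F.map_smul_univ, Polynomial.eval_mul, Polynomial.eval_C, Polynomial.eval_prod,
      smul_eq_mul, mul_comm]
  -- By invariance `Q` is constant on the infinite set of non-zero scalars, hence constant; its
  -- value at 0 then shows that the invariant vanishes at `x`.
  have hQ' : Q = Polynomial.C (F fun _ => x) := by
    refine Polynomial.eq_of_infinite_eval_eq _ _ ?_
    refine (Set.finite_singleton (0 : k)).infinite_compl.mono fun t ht => ?_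
    rw [Set.mem_ofPred_eq, Polynomial.eval_C]
    exact hQ (Units.mk0 t ht)
  have h0 : Q.eval 0 = 0 := by
    rw [Polynomial.eval_finsetSum]
    refine Finset.sum_eq_zero fun r _ => ?_
    rw [Polynomial.eval_mul, Polynomial.eval_prod,
      Finset.prod_eq_zero (Finset.mem_univ (⟨0, hd⟩ : Fin d)) (hp _), mul_zero]
  rw [hQ', Polynomial.eval_C] at h0
  exact hx h0

theorem not_isSemistable_of_eigenvector (ρ : Representation k G W) {x : W} {γ : kˣ →* G} {K : ℤ}
    (hK : K ≠ 0) (h : ∀ t : kˣ, ρ (γ t) x = ((t ^ K : kˣ) : k) • x) : ¬ IsSemistable ρ x := by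
  have key : ∀ (γ : kˣ →* G) (K : ℕ), K ≠ 0 →
      (∀ t : kˣ, ρ (γ t) x = ((t ^ (K : ℤ) : kˣ) : k) • x) → ¬ IsSemistable ρ x := by
    intro γ K hK h
    refine not_isSemistable_of_forall_eq_sum (ι := Unit) ρ x γ (fun _ => Polynomial.X ^ K)
      (fun _ => x) (fun _ => by simp [hK]) fun t => ?_
    rw [h t]
    simp
  obtain ⟨K, rfl | rfl⟩ := K.eq_nat_or_neg
  · exact key γ K (by simpa using hK) h
  -- For a negative weight the inverse subgroup makes the exponent positive.
  · refine key (γ.comp invMonoidHom) K (by simpa using hK) fun t => ?_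
    rw [MonoidHom.comp_apply, h, invMonoidHom_apply, inv_zpow, zpow_neg, inv_inv]

end Criterion

end GIT

end

noncomputable section

namespace Ribbon

open TrivSqZeroExt GIT

variable {k : Type u} [Field k] {ℓ e n m : ℕ}

/-! ### Dimensions -/

theorem finite_sections (hn : 1 ≤ n) (he : 1 ≤ e) :
    Module.Finite k (sections (ℓ + e + 1) (monomialF k ℓ) n) :=
  Module.Finite.of_basis (sectionBasis hn he)

theorem finrank_sections (hn : 1 ≤ n) (he : 1 ≤ e) :
    Module.finrank k (sections (ℓ + e + 1) (monomialF k ℓ) n) = Fintype.card (SecIndex ℓ e n) :=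
  Module.finrank_eq_card_basis (sectionBasis hn he)

/-! ### The torus action on sections -/

theorem scale_inl_X_pow (a b : kˣ) (w : ℕ) :
    scale a b (inl (Polynomial.X ^ w)) = (a ^ w : k) • inl (Polynomial.X ^ w) := by
  rw [scale, DualNumber.lift_apply_apply]
  simp [mul_pow, ← inl_smul, Polynomial.smul_eq_C_mul]

theorem scale_inr_C_mul_X_pow (a b : kˣ) (c : k) (w : ℕ) :
    scale a b (inr (Polynomial.C c * Polynomial.X ^ w)) =
      (a ^ w * b : k) • inr (Polynomial.C c * Polynomial.X ^ w) := by
  rw [scale, DualNumber.lift_apply_apply]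
  simp only [AlgHom.comp_apply]
  ext1
  · simp
  · simp [mul_pow, Polynomial.smul_eq_C_mul]
    ring

/-- When ε scales by a^s, the element x^(-s) ε is invariant, so both terms have weight `w`. -/
theorem scale_add (a : kˣ) {s w : ℕ} {c : k} (h : c = 0 ∨ s ≤ w) :
    scale a (a ^ s) (inl (Polynomial.X ^ w) + inr (Polynomial.C c * Polynomial.X ^ (w - s))) =
      (a ^ w : k) •
        (inl (Polynomial.X ^ w) + inr (Polynomial.C c * Polynomial.X ^ (w - s))) := by
  rw [map_add, scale_inl_X_pow, scale_inr_C_mul_X_pow, smul_add]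
  rcases h with rfl | h
  · simp
  · rw [Units.val_pow_eq_pow_val, ← pow_add, Nat.sub_add_cancel h]

/-- The pullback of functions on the two charts under the standard action. -/
def torusHom (ℓ e : ℕ) (τ : kˣ) : Chart k × Chart k →ₐ[k] Chart k × Chart k :=
  (scale τ (τ ^ (e + 1))).prodMap (scale τ⁻¹ (τ⁻¹ ^ (ℓ + 1)))

theorem torusHom_apply (τ : kˣ) (s : Chart k × Chart k) :
    torusHom ℓ e τ s = (scale τ (τ ^ (e + 1)) s.1, scale τ⁻¹ (τ⁻¹ ^ (ℓ + 1)) s.2) :=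
  rfl

/-- The weights of the basis sections. -/
def secWeight (ℓ e n : ℕ) : SecIndex ℓ e n → ℕ :=
  Sum.elim (fun w => w) fun j => j + (e + 1)

variable (ℓ e) in
/-- The factor of a linearization of the standard action on the dualizing sheaf. -/
def torusFactor (κ τ : kˣ) : Chart k × Chart k :=
  (algebraMap k _ (κ : k), algebraMap k _ (κ * τ ^ (ℓ + e) : k))

theorem torusFactor_pow_mul (κ τ : kˣ) (n : ℕ) (s : Chart k × Chart k) :
    torusFactor ℓ e κ τ ^ n * s =
      ((κ ^ n : k) • s.1, (κ ^ n * τ ^ (n * (ℓ + e)) : k) • s.2) := by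
  rw [torusFactor, Prod.pow_mk, ← map_pow, ← map_pow, mul_pow, ← pow_mul, mul_comm (ℓ + e),
    Algebra.smul_def, Algebra.smul_def]
  rfl

theorem torus_regSection {w : ℕ} {c : k} (hw : w ≤ n * (ℓ + e)) (hc : c = 0 ∨ e + 1 ≤ w)
    (hc' : (n * e - w + c : k) = 0 ∨ w + ℓ + 1 ≤ n * (ℓ + e)) (κ τ : kˣ) :
    torusFactor ℓ e κ τ ^ n * torusHom ℓ e τ (regSection ℓ e n w c) =
      (κ ^ n * τ ^ w : k) • regSection ℓ e n w c := by
  have h : (n * e - w + c : k) = 0 ∨ ℓ + 1 ≤ n * (ℓ + e) - w := hc'.imp_right fun h => by omega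
  have h1 : (κ ^ n * τ ^ (n * (ℓ + e)) * (τ⁻¹ : kˣ) ^ (n * (ℓ + e) - w) : k) = κ ^ n * τ ^ w := by
    obtain ⟨v, hv⟩ := Nat.exists_eq_add_of_le hw
    rw [hv, Nat.add_sub_cancel_left, pow_add, mul_assoc, mul_assoc, ← mul_pow, Units.mul_inv,
      one_pow, mul_one]
  rw [torusFactor_pow_mul, torusHom_apply, regSection, scale_add τ hc,
    map_smul, scale_add τ⁻¹ h, Prod.smul_mk, smul_smul, smul_comm ((-1 : k) ^ n) _ (_ + _),
    smul_smul, h1]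

theorem torus_nilSection {j : ℕ} (hj : j + (ℓ + e + 2) ≤ n * (ℓ + e)) (κ τ : kˣ) :
    torusFactor ℓ e κ τ ^ n * torusHom ℓ e τ (nilSection k ℓ e n j) =
      (κ ^ n * τ ^ (j + (e + 1)) : k) • nilSection k ℓ e n j := by
  have h1 : (κ ^ n * τ ^ (n * (ℓ + e)) * ((τ⁻¹ : kˣ) ^ (n * (ℓ + e) - (ℓ + e + 2) - j) *
      (τ⁻¹ ^ (ℓ + 1) : kˣ)) : k) = κ ^ n * τ ^ (j + (e + 1)) := by
    obtain ⟨v, hv⟩ := Nat.exists_eq_add_of_le hj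
    have h2 : j + (ℓ + e + 2) + v - (ℓ + e + 2) - j = v := by omega
    have h3 : j + (ℓ + e + 2) + v = j + (e + 1) + (v + (ℓ + 1)) := by omega
    rw [hv, h2, h3, Units.val_pow_eq_pow_val, ← pow_add, mul_assoc, pow_add (τ : k), mul_assoc,
      ← mul_pow, Units.mul_inv, one_pow, mul_one]
  have h2 := fun w : ℕ => scale_inr_C_mul_X_pow τ (τ ^ (e + 1)) 1 w
  have h3 := fun w : ℕ => scale_inr_C_mul_X_pow τ⁻¹ (τ⁻¹ ^ (ℓ + 1)) 1 w
  simp only [map_one, one_mul] at h2 h3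
  rw [torusFactor_pow_mul, torusHom_apply, nilSection, h2,
    map_smul, h3, Prod.smul_mk, smul_smul, smul_comm ((-1 : k) ^ n),
    smul_smul, h1, Units.val_pow_eq_pow_val, ← pow_add]

theorem torus_basisSection (hn : 1 ≤ n) (he : 1 ≤ e) (κ τ : kˣ) (i : SecIndex ℓ e n) :
    torusFactor ℓ e κ τ ^ n * torusHom ℓ e τ (basisSection ℓ e n i) =
      (κ ^ n * τ ^ secWeight ℓ e n i : k) • basisSection ℓ e n i := by
  rcases i with ⟨w, hw⟩ | ⟨j, hj⟩
  · exact torus_regSection (Nat.lt_succ_iff.mp hw) (regCoeff_eq_zero_or hn he)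
      (regCoeff_add_eq_zero_or _ _ _ _) κ τ
  · exact torus_nilSection (by omega) κ τ

/-- The action of the torus on the space of sections. -/
def torusMap (hn : 1 ≤ n) (he : 1 ≤ e) (κ τ : kˣ) :
    sections (ℓ + e + 1) (monomialF k ℓ) n →ₗ[k] sections (ℓ + e + 1) (monomialF k ℓ) n :=
  diagMap (sectionBasis hn he) fun i => κ ^ n * τ ^ secWeight ℓ e n i

theorem coe_torusMap (hn : 1 ≤ n) (he : 1 ≤ e) (κ τ : kˣ)
    (s : sections (ℓ + e + 1) (monomialF k ℓ) n) :
    (torusMap hn he κ τ s : Chart k × Chart k) =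
      torusFactor ℓ e κ τ ^ n * torusHom ℓ e τ s := by
  have h : (sections (ℓ + e + 1) (monomialF k ℓ) n).subtype ∘ₗ torusMap hn he κ τ =
      LinearMap.mulLeft k (torusFactor ℓ e κ τ ^ n) ∘ₗ (torusHom ℓ e τ).toLinearMap ∘ₗ
        (sections (ℓ + e + 1) (monomialF k ℓ) n).subtype :=
    (sectionBasis hn he).ext fun i => by
      have h1 := torus_basisSection hn he κ τ i
      rw [← sectionBasis_apply hn he i] at h1
      rw [LinearMap.comp_apply, torusMap, diagMap_basis, map_smul]
      exact h1.symm
  exact DFunLike.congr_fun h s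

theorem restrictSym_torusMap (hn : 1 ≤ n) (hm : 1 ≤ m) (he : 1 ≤ e) (κ τ : kˣ) :
    restrictSym (ℓ + e + 1) (monomialF k ℓ) n m ∘ₗ symPowMap (torusMap hn he κ τ) m =
      torusMap (Nat.mul_pos hn hm) he κ τ ∘ₗ restrictSym (ℓ + e + 1) (monomialF k ℓ) n m := by
  ext1 z
  refine Subtype.ext ?_
  rw [LinearMap.comp_apply, LinearMap.comp_apply, coe_torusMap, pow_mul]
  exact (symPowLift_symPowMap _ _ m z).trans
    (symPowLift_eq_pow_mul (torusHom ℓ e τ) _ (coe_torusMap hn he κ τ) m z)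

/-- Automorphisms of the ribbon commute with restriction of hypersurfaces, so their effect on the
source moves to the target, where the top exterior power is scaled by the determinant. -/
theorem hilbertPoint_torusMap (hn : 1 ≤ n) (hm : 1 ≤ m) (he : 1 ≤ e) (κ τ : kˣ) (b) :
    (hilbertPoint (ℓ + e + 1) (monomialF k ℓ) n m b).compLinearMap
        (symPowMap (torusMap hn he κ τ) m) =
      (∏ i, κ ^ (n * m) * τ ^ secWeight ℓ e (n * m) i : k) •
        hilbertPoint (ℓ + e + 1) (monomialF k ℓ) n m b := by
  rw [hilbertPoint, AlternatingMap.compLinearMap_assoc, restrictSym_torusMap hn hm he,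
    det_compLinearMap_comp, torusMap, det_diagMap]

end Ribbon

end

noncomputable section

namespace GIT

theorem diagSubgroup_inv {k V ι : Type*} [Field k] [AddCommGroup V] [Module k V] [Fintype ι]
    [DecidableEq ι] (b : Module.Basis ι k V) (wt : ι → ℤ) (h : ∑ i, wt i = 0) (t : kˣ) :
    ((diagSubgroup b wt h t)⁻¹ : SpecialLinearGroup k V).1.toLinearMap =
      diagMap b fun i => ((t⁻¹ ^ wt i : kˣ) : k) := by
  rw [← map_inv]
  rfl

end GIT

namespace Ribbon

open GIT

variable {k : Type u} [Field k] {ℓ e m : ℕ}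

/-! ### The canonical embedding -/

theorem two_mul_sum_fin (n : ℕ) : 2 * ∑ i : Fin n, ((i : ℕ) : ℤ) = n * (n - 1) := by
  induction n with
  | zero => simp
  | succ n ih =>
    rw [Fin.sum_univ_castSucc, mul_add]
    simp only [Fin.val_castSucc, Fin.val_last, ih]
    push_cast
    ring

theorem two_mul_sum_secWeight (ℓ e n : ℕ) {D M : ℤ} (hD : (n * (ℓ + e) : ℕ) = D)
    (hM : (n * (ℓ + e) - (ℓ + e + 1) : ℕ) = M) :
    2 * ∑ i, (secWeight ℓ e n i : ℤ) = (D + 1) * D + M * (M - 1) + 2 * (e + 1) * M := by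
  have h1 := two_mul_sum_fin (n * (ℓ + e) + 1)
  have h2 := two_mul_sum_fin (n * (ℓ + e) - (ℓ + e + 1))
  rw [hM] at h2
  rw [Nat.cast_add, hD] at h1
  rw [Fintype.sum_sum_type]
  simp only [secWeight, Sum.elim_inl, Sum.elim_inr, Nat.cast_add, Finset.sum_add_distrib,
    Finset.sum_const, Finset.card_univ, Fintype.card_fin, nsmul_eq_mul, hM]
  push_cast at h1 ⊢
  linear_combination h1 + h2

theorem card_secIndex_eq (ℓ e n : ℕ) {D M : ℤ} (hD : (n * (ℓ + e) : ℕ) = D)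
    (hM : (n * (ℓ + e) - (ℓ + e + 1) : ℕ) = M) :
    (Fintype.card (SecIndex ℓ e n) : ℤ) = D + 1 + M := by
  rw [Fintype.card_sum, Fintype.card_fin, Fintype.card_fin, ← hD, ← hM]
  push_cast
  rfl

theorem sum_torus_weights (ℓ e : ℕ) {α β : ℤ} (h : 2 * β = -(α * (ℓ + e))) :
    ∑ i : SecIndex ℓ e 1, (α * secWeight ℓ e 1 i + β) = 0 := by
  have h0 : 1 * (ℓ + e) - (ℓ + e + 1) = 0 := by omega
  have h1 := two_mul_sum_secWeight ℓ e 1 (M := 0) rfl (by rw [h0]; rfl)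
  have h2 := card_secIndex_eq ℓ e 1 (M := 0) rfl (by rw [h0]; rfl)
  rw [Finset.sum_add_distrib, ← Finset.mul_sum, Finset.sum_const, Finset.card_univ, nsmul_eq_mul,
    h2]
  push_cast at h1 ⊢
  refine mul_left_cancel₀ (two_ne_zero (α := ℤ)) ?_
  linear_combination α * h1 + (ℓ + e + 1) * h

/-- The one-parameter subgroups of `SL(H⁰(C_ℓ, ω))` induced by the standard action. -/
def torusSubgroup (he : 1 ≤ e) {α β : ℤ} (h : 2 * β = -(α * (ℓ + e))) :
    kˣ →* SpecialLinearGroup k (sections (ℓ + e + 1) (monomialF k ℓ) 1) :=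
  diagSubgroup (sectionBasis le_rfl he) _ (sum_torus_weights ℓ e h)

/-- The constraint on `β` centres the weights of H⁰(ω). In H⁰(ω^m) the weights 0, …, m(ℓ+e) then
cancel, and each of the (m-1)(ℓ+e) - 1 nilpotent sections contributes α(e-ℓ)/2 on average. The sign
of `K` reflects the contragredient action. -/
theorem hilbertRep_torusSubgroup (he : 1 ≤ e) (hm : 2 ≤ m) {α β : ℤ}
    (h : 2 * β = -(α * (ℓ + e))) {K : ℤ}
    (hK : 2 * K = -(α * ((m - 1) * (ℓ + e) - 1) * (e - ℓ))) (t : kˣ) (b) :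
    hilbertRep k (sections (ℓ + e + 1) (monomialF k ℓ) 1) m _ (torusSubgroup he h t)
        (hilbertPoint (ℓ + e + 1) (monomialF k ℓ) 1 m b) =
      ((t ^ K : kˣ) : k) • hilbertPoint (ℓ + e + 1) (monomialF k ℓ) 1 m b := by
  have h1 : ((torusSubgroup he h t)⁻¹ : SpecialLinearGroup k
      (sections (ℓ + e + 1) (monomialF k ℓ) 1)).1.toLinearMap =
        torusMap le_rfl he (t⁻¹ ^ β) (t⁻¹ ^ α) := by
    rw [torusSubgroup, diagSubgroup_inv, torusMap]
    congr 1
    ext i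
    rw [pow_one, zpow_add, zpow_mul, zpow_natCast, Units.val_mul, mul_comm,
      Units.val_pow_eq_pow_val]
  change (hilbertPoint (ℓ + e + 1) (monomialF k ℓ) 1 m b).compLinearMap (symPowMap _ m) = _
  rw [h1, hilbertPoint_torusMap le_rfl (by omega)]
  congr 1
  simp only [← Units.val_pow_eq_pow_val, ← Units.val_mul, ← Units.coe_prod]
  congr 1
  have hM : ((1 * m * (ℓ + e) - (ℓ + e + 1) : ℕ) : ℤ) = (m - 1) * (ℓ + e) - 1 := by
    obtain ⟨m, rfl⟩ := Nat.exists_eq_add_of_le hm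
    rw [show 1 * (2 + m) * (ℓ + e) = m * (ℓ + e) + (ℓ + e) + (ℓ + e) by ring, Nat.cast_sub (by omega)]
    push_cast
    ring
  have h2 := two_mul_sum_secWeight ℓ e (1 * m) rfl hM
  have h3 := card_secIndex_eq ℓ e (1 * m) rfl hM
  have h4 : ∏ i : SecIndex ℓ e (1 * m), (t⁻¹ ^ β) ^ (1 * m) * (t⁻¹ ^ α) ^ secWeight ℓ e (1 * m) i =
      t ^ ∑ i : SecIndex ℓ e (1 * m), -(β * (1 * m : ℕ) + α * secWeight ℓ e (1 * m) i) := by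
    refine Eq.trans (Finset.prod_congr rfl fun i _ => ?_)
      (map_sum (zmultiplesHom (Additive kˣ) (Additive.ofMul t)) _ Finset.univ).symm
    change _ = t ^ (_ : ℤ)
    rw [← zpow_natCast, ← zpow_natCast, ← zpow_mul, ← zpow_mul, ← zpow_add, inv_zpow,
      ← zpow_neg]
  rw [h4]
  congr 1
  rw [Finset.sum_neg_distrib, Finset.sum_add_distrib, Finset.sum_const, Finset.card_univ,
    nsmul_eq_mul, h3, ← Finset.mul_sum]
  refine mul_left_cancel₀ (two_ne_zero (α := ℤ)) ?_
  push_cast at h2 ⊢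
  linear_combination -α * h2 - hK - m * (2 * m - 1) * (ℓ + e) * h

end Ribbon

end

/-! ### Instability and strict semistability of the canonical embedding -/

noncomputable section

namespace GIT

theorem isHilbertMumfordIndex_zero {k G W : Type*} [Field k] [Group G] [AddCommGroup W]
    [Module k W] {ρ : Representation k G W} {σ : kˣ →* G} {x : W} (hx : x ≠ 0)
    (h : ∀ t, ρ (σ t) x = x) : IsHilbertMumfordIndex ρ σ x 0 := by
  refine ⟨Finsupp.single 0 x, fun i t => ?_, Finsupp.sum_single_index rfl, ?_, fun j hj => ?_⟩
  · by_cases hi : i = 0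
    · rw [hi, Finsupp.single_eq_same, h, zpow_zero, Units.val_one, one_smul]
    · rw [Finsupp.single_eq_of_ne hi, map_zero, smul_zero]
  · rw [Set.mem_ofPred_eq, neg_zero, Finsupp.single_eq_same]
    exact hx
  · by_contra hj'
    exact hj (Finsupp.single_eq_of_ne (by omega))

end GIT

namespace Ribbon

open GIT

variable {k : Type u} [Field k] {ℓ e m : ℕ}

theorem hilbertUnstable_one [CharZero k] (hℓ : 1 ≤ ℓ) (he : 1 ≤ e) (hne : e ≠ ℓ) (hm : 2 ≤ m) :
    HilbertUnstable (ℓ + e + 1) (monomialF k ℓ) 1 m := by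
  intro b
  refine ⟨hilbertPoint_ne_zero hℓ he le_rfl (by omega) b, ?_⟩
  -- Doubling the torus weights keeps `β` integral even when ℓ + e is odd.
  refine not_isSemistable_of_eigenvector _ (γ := torusSubgroup he (α := 2) (β := -(ℓ + e)) (by ring))
    (K := -(((m - 1) * (ℓ + e) - 1) * (e - ℓ))) ?_ fun t =>
      hilbertRep_torusSubgroup he hm _ (by ring) t b
  refine neg_ne_zero.mpr (mul_ne_zero ?_ (sub_ne_zero.mpr (by exact_mod_cast hne)))
  have h1 : (1 : ℤ) ≤ m - 1 := by omega
  have h2 : (2 : ℤ) ≤ ℓ + e := by omega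
  nlinarith

/-- For ℓ = e the pullback of forms has determinant 1 without renormalization: the generator on the
first chart is multiplied by t / t^(e+1) = t^(-e), which is exactly the centring factor. -/
theorem isInducedSubgroup_torusSubgroup (he : 1 ≤ e)
    (h : 2 * (-e : ℤ) = -(1 * ((e : ℕ) + (e : ℕ)))) :
    IsInducedSubgroup (e + e + 1) e 1 (torusSubgroup (k := k) he h) := by
  intro t s
  have h1 : (torusSubgroup he h t).1.toLinearMap =
      torusMap (k := k) (ℓ := e) le_rfl he (t ^ (-e : ℤ)) t := by
    change diagMap _ _ = diagMap _ _
    congr 1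
    ext i
    change ((t ^ (1 * (secWeight e e 1 i : ℤ) + -(e : ℤ)) : kˣ) : k) = _
    rw [one_mul, pow_one, zpow_add, zpow_natCast, Units.val_mul, mul_comm,
      Units.val_pow_eq_pow_val]
  have h2 := coe_torusMap le_rfl he (t ^ (-e : ℤ)) t s
  rw [← h1, torusFactor_pow_mul, torusHom_apply] at h2
  refine h2.trans ?_
  have e1 : ((e + e + 1 : ℕ) : ℤ) - e = (e + 1 : ℕ) := by push_cast; ring
  have e2 : t ^ (-(e : ℤ) - 1) = t⁻¹ ^ (e + 1) := by
    rw [← zpow_natCast, inv_zpow, ← zpow_neg]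
    congr 1
    push_cast
    ring
  rw [e1, e2, zpow_natCast, scaleForm, scaleForm]
  have e3 : t ^ (-e : ℤ) = t / t ^ (e + 1) := by
    rw [zpow_neg, zpow_natCast, pow_succ', div_mul_cancel_left]
  have e4 : t / t ^ (e + 1) * t ^ (1 * (e + e)) = t⁻¹ / t⁻¹ ^ (e + 1) := by
    rw [pow_succ', pow_succ', div_mul_cancel_left, div_mul_cancel_left, inv_pow, inv_inv, one_mul,
      pow_add, inv_mul_cancel_left]
  rw [e3, ← Units.val_pow_eq_pow_val, ← Units.val_pow_eq_pow_val, ← Units.val_mul, pow_one, e4,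
    pow_one]

theorem exists_isInducedSubgroup [CharZero k] (he : 1 ≤ e) :
    ∃ σ : kˣ →* SpecialLinearGroup k (sections (e + e + 1) (monomialF k e) 1),
      IsInducedSubgroup (e + e + 1) e 1 σ ∧ ∀ m : ℕ, 2 ≤ m → ∀ b,
        IsStrictlySemistableWrt (hilbertRep k (sections (e + e + 1) (monomialF k e) 1) m _) σ
          (hilbertPoint (e + e + 1) (monomialF k e) 1 m b) := by
  have h : 2 * (-e : ℤ) = -(1 * ((e : ℕ) + (e : ℕ))) := by ring
  have key : ∀ m : ℕ, 2 ≤ m → ∀ t b, hilbertRep k (sections (e + e + 1) (monomialF k e) 1) m _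
      (torusSubgroup he h t) (hilbertPoint (e + e + 1) (monomialF k e) 1 m b) =
        hilbertPoint (e + e + 1) (monomialF k e) 1 m b := by
    intro m hm t b
    rw [hilbertRep_torusSubgroup he hm h (K := 0) (by ring), zpow_zero, Units.val_one, one_smul]
  refine ⟨torusSubgroup he h, isInducedSubgroup_torusSubgroup he h, fun m hm b => ?_⟩
  have hx := hilbertPoint_ne_zero (k := k) he he le_rfl (show 1 ≤ m by omega) b
  exact ⟨isHilbertMumfordIndex_zero hx fun t => key m hm t b,
    isHilbertMumfordIndex_zero hx fun t => key m hm t⁻¹ b⟩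

end Ribbon

end

noncomputable section

namespace GIT

/-- Here `p` and `q` are complementary projections. The lemma rewrites x + s y as the image under
the diagonal map p + s q of an expression involving only r = s⁻¹. -/
theorem add_smul_apply_of_isProj {k W : Type*} [Field k] [AddCommGroup W] [Module k W]
    {p q : W →ₗ[k] W} (h : p + q = LinearMap.id) (hp : ∀ w, p (p w) = p w) {s r : k}
    (hsr : s * r = 1) (x : W) {y : W} (hy : p y = 0) :
    (p + s • q) (p x + y + r • q x) = x + s • y := by
  obtain rfl : q = LinearMap.id - p := eq_sub_of_add_eq' h
  simp only [LinearMap.add_apply, LinearMap.smul_apply, LinearMap.sub_apply, LinearMap.id_apply,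
    map_add, map_smul, map_sub, hp, hy, sub_self, smul_zero, add_zero]
  linear_combination (norm := module) hsr • (x - p x)

end GIT

namespace Ribbon

open TrivSqZeroExt GIT

variable {k : Type u} [Field k] {ℓ e n m : ℕ}

/-! ### Destabilizing pluricanonical embeddings -/

variable (k) in
/-- The ideal of pairs of nilpotent functions. -/
def nilIdeal : Ideal (Chart k × Chart k) :=
  RingHom.ker ((fstHom k (Polynomial k) (Polynomial k)).prodMap
    (fstHom k (Polynomial k) (Polynomial k)))

theorem mem_nilIdeal {s : Chart k × Chart k} : s ∈ nilIdeal k ↔ s.1.fst = 0 ∧ s.2.fst = 0 := by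
  rw [nilIdeal, RingHom.mem_ker]
  exact Prod.ext_iff

theorem mul_eq_zero_of_mem_nilIdeal {s t : Chart k × Chart k} (hs : s ∈ nilIdeal k)
    (ht : t ∈ nilIdeal k) : s * t = 0 := by
  rw [mem_nilIdeal] at hs ht
  refine Prod.ext (TrivSqZeroExt.ext ?_ ?_) (TrivSqZeroExt.ext ?_ ?_) <;> simp [hs, ht]

/-- The diagonal map with eigenvalues `a` on the sections `regSection` and `c` on the sections
`nilSection`. -/
def twoStepMap (hn : 1 ≤ n) (he : 1 ≤ e) (a c : k) :
    sections (ℓ + e + 1) (monomialF k ℓ) n →ₗ[k] sections (ℓ + e + 1) (monomialF k ℓ) n :=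
  diagMap (sectionBasis hn he) (Sum.elim (fun _ => a) fun _ => c)

theorem twoStepMap_eq (hn : 1 ≤ n) (he : 1 ≤ e) (a c : k) :
    twoStepMap (ℓ := ℓ) hn he a c = a • twoStepMap hn he 1 0 + c • twoStepMap hn he 0 1 := by
  refine (sectionBasis hn he).ext fun i => ?_
  rw [LinearMap.add_apply, LinearMap.smul_apply, LinearMap.smul_apply]
  simp only [twoStepMap, diagMap_basis]
  rcases i with i | i <;> simp

theorem twoStepMap_one_one (hn : 1 ≤ n) (he : 1 ≤ e) :
    twoStepMap (k := k) (ℓ := ℓ) hn he 1 1 = LinearMap.id := by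
  rw [← diagMap_one (sectionBasis hn he), twoStepMap]
  congr 1
  ext (i | i) <;> rfl

theorem twoStepMap_comp (hn : 1 ≤ n) (he : 1 ≤ e) (a c a' c' : k)
    (s : sections (ℓ + e + 1) (monomialF k ℓ) n) :
    twoStepMap hn he a c (twoStepMap hn he a' c' s) = twoStepMap hn he (a * a') (c * c') s := by
  rw [← LinearMap.comp_apply, twoStepMap, twoStepMap, diagMap_comp, twoStepMap]
  congr 2
  ext (i | i) <;> rfl

theorem det_twoStepMap (hn : 1 ≤ n) (he : 1 ≤ e) (a c : k) :
    LinearMap.det (twoStepMap (ℓ := ℓ) hn he a c) =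
      a ^ (n * (ℓ + e) + 1) * c ^ (n * (ℓ + e) - (ℓ + e + 1)) := by
  rw [twoStepMap, det_diagMap, Fintype.prod_sum_type]
  simp

theorem twoStepMap_zero_one_mem (hn : 1 ≤ n) (he : 1 ≤ e)
    (s : sections (ℓ + e + 1) (monomialF k ℓ) n) :
    (twoStepMap hn he 0 1 s : Chart k × Chart k) ∈ nilIdeal k := by
  have h : s ∈ Submodule.span k (Set.range (sectionBasis (k := k) (ℓ := ℓ) hn he)) := by
    rw [(sectionBasis hn he).span_eq]
    exact Submodule.mem_top
  induction h using Submodule.span_induction with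
  | zero => rw [map_zero]; exact (nilIdeal k).zero_mem
  | add x y _ _ hx hy => rw [map_add]; exact (nilIdeal k).add_mem hx hy
  | smul c x _ hx => rw [map_smul]; exact ((nilIdeal k).restrictScalars k).smul_mem c hx
  | mem x hx =>
    obtain ⟨i, rfl⟩ := hx
    rw [twoStepMap, diagMap_basis, Submodule.coe_smul, sectionBasis_apply]
    rcases i with i | i
    · rw [Sum.elim_inl, zero_smul]
      exact (nilIdeal k).zero_mem
    · rw [Sum.elim_inr, one_smul, mem_nilIdeal]
      exact ⟨fst_inr _ _, by simp [basisSection, nilSection]⟩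

theorem twoStepMap_one_zero_eq_zero (hn : 1 ≤ n) (he : 1 ≤ e)
    {s : sections (ℓ + e + 1) (monomialF k ℓ) n} (hs : (s : Chart k × Chart k) ∈ nilIdeal k) :
    twoStepMap hn he 1 0 s = 0 := by
  rw [← (sectionBasis hn he).sum_repr s, map_sum]
  refine Finset.sum_eq_zero fun i _ => ?_
  rw [map_smul, twoStepMap, diagMap_basis]
  rcases i with i | i
  · have h : (sectionBasis hn he).repr s (Sum.inl i) = 0 := by
      rw [sectionBasis, Module.Basis.ofEquivFun_repr_apply]
      change s.1.1.fst.coeff i = 0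
      rw [(mem_nilIdeal.mp hs).1, Polynomial.coeff_zero]
    rw [h, zero_smul]
  · rw [Sum.elim_inr, zero_smul, smul_zero]

theorem subtype_comp_twoStepMap (hn : 1 ≤ n) (he : 1 ≤ e) (a s : k) :
    (sections (ℓ + e + 1) (monomialF k ℓ) n).subtype ∘ₗ twoStepMap hn he a (a * s) =
      a • ((sections (ℓ + e + 1) (monomialF k ℓ) n).subtype ∘ₗ twoStepMap hn he 1 0 +
        s • (sections (ℓ + e + 1) (monomialF k ℓ) n).subtype ∘ₗ twoStepMap hn he 0 1) := by
  rw [twoStepMap_eq, LinearMap.comp_add, LinearMap.comp_smul, LinearMap.comp_smul, smul_add,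
    smul_smul]

theorem subtype_comp_twoStepMap_add (hn : 1 ≤ n) (he : 1 ≤ e) :
    (sections (ℓ + e + 1) (monomialF k ℓ) n).subtype ∘ₗ twoStepMap hn he 1 0 +
      (sections (ℓ + e + 1) (monomialF k ℓ) n).subtype ∘ₗ twoStepMap hn he 0 1 =
        (sections (ℓ + e + 1) (monomialF k ℓ) n).subtype := by
  have h := subtype_comp_twoStepMap (ℓ := ℓ) hn he (1 : k) 1
  rw [one_mul, one_smul, one_smul, twoStepMap_one_one, LinearMap.comp_id] at h
  exact h.symm

variable (ℓ n) in
/-- The composition of the restriction map with the projection to the span of the sections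
`regSection`. -/
def restrictReg (hn : 1 ≤ n) (he : 1 ≤ e) (m : ℕ) :
    symPow k (sections (ℓ + e + 1) (monomialF k ℓ) n) m →ₗ[k]
      sections (ℓ + e + 1) (monomialF k ℓ) (n * m) :=
  restrictSym (ℓ + e + 1) (monomialF k ℓ) n m ∘ₗ symPowMap (twoStepMap hn he 1 0) m

theorem coe_restrictReg (hn : 1 ≤ n) (he : 1 ≤ e) (m : ℕ)
    (z : symPow k (sections (ℓ + e + 1) (monomialF k ℓ) n) m) :
    (restrictReg ℓ n hn he m z : Chart k × Chart k) =
      symPowLift ((sections (ℓ + e + 1) (monomialF k ℓ) n).subtype ∘ₗ twoStepMap hn he 1 0) m z :=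
  symPowLift_symPowMap _ _ m z

theorem restrictSym_sub_restrictReg_mem (hn : 1 ≤ n) (he : 1 ≤ e) (m : ℕ)
    (z : symPow k (sections (ℓ + e + 1) (monomialF k ℓ) n) m) :
    ((restrictSym (ℓ + e + 1) (monomialF k ℓ) n m z - restrictReg ℓ n hn he m z :
      sections (ℓ + e + 1) (monomialF k ℓ) (n * m)) : Chart k × Chart k) ∈ nilIdeal k := by
  have h := (symPowLift_add_smul (φ₀ := (sections (ℓ + e + 1) (monomialF k ℓ) n).subtype ∘ₗ
    twoStepMap hn he 1 0) (φ₁ := (sections (ℓ + e + 1) (monomialF k ℓ) n).subtype ∘ₗ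
    twoStepMap hn he 0 1) (fun x hx y hy => mul_eq_zero_of_mem_nilIdeal hx hy)
      (twoStepMap_zero_one_mem hn he) m z).1
  rw [subtype_comp_twoStepMap_add] at h
  rw [Submodule.coe_sub, coe_restrictReg]
  exact h

/-- Monomials with two or more nilpotent factors restrict to zero, so after extracting a^m only the
powers s⁰ and s¹ occur. -/
theorem restrictSym_twoStepMap (hn : 1 ≤ n) (he : 1 ≤ e) (m : ℕ) (a s : k)
    (z : symPow k (sections (ℓ + e + 1) (monomialF k ℓ) n) m) :
    restrictSym (ℓ + e + 1) (monomialF k ℓ) n m (symPowMap (twoStepMap hn he a (a * s)) m z) =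
      a ^ m • (restrictReg ℓ n hn he m z +
        s • (restrictSym (ℓ + e + 1) (monomialF k ℓ) n m z - restrictReg ℓ n hn he m z)) := by
  have h := (symPowLift_add_smul (φ₀ := (sections (ℓ + e + 1) (monomialF k ℓ) n).subtype ∘ₗ
    twoStepMap hn he 1 0) (φ₁ := (sections (ℓ + e + 1) (monomialF k ℓ) n).subtype ∘ₗ
    twoStepMap hn he 0 1) (fun x hx y hy => mul_eq_zero_of_mem_nilIdeal hx hy)
      (twoStepMap_zero_one_mem hn he) m z).2 s
  rw [subtype_comp_twoStepMap_add] at h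
  rw [← coe_restrictReg] at h
  refine Subtype.ext ((symPowLift_symPowMap _ _ m z).trans ?_)
  rw [subtype_comp_twoStepMap, symPowLift_smul, h]
  rfl

theorem twoStepMap_apply_add (hn : 1 ≤ n) (he : 1 ≤ e) {a s r : k} (hsr : s * r = 1)
    (x : sections (ℓ + e + 1) (monomialF k ℓ) n) {y : sections (ℓ + e + 1) (monomialF k ℓ) n}
    (hy : (y : Chart k × Chart k) ∈ nilIdeal k) :
    twoStepMap hn he a (a * s)
        (twoStepMap hn he 1 0 x + y + r • twoStepMap hn he 0 1 x) = a • (x + s • y) := by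
  have h1 := twoStepMap_eq (ℓ := ℓ) hn he (1 : k) 1
  rw [twoStepMap_one_one, one_smul, one_smul] at h1
  have h2 := twoStepMap_comp (ℓ := ℓ) (k := k) hn he 1 0 1 0
  rw [mul_one, mul_zero] at h2
  rw [twoStepMap_eq, mul_smul, ← smul_add, LinearMap.smul_apply,
    add_smul_apply_of_isProj h1.symm h2 hsr x (twoStepMap_one_zero_eq_zero hn he hy)]

/-- The restriction map, precomposed with `twoStepMap`, is up to scaling the sum of two maps whose
ratio varies. -/
theorem exists_restrictSym_comp_twoStepMap (hn : 1 ≤ n) (hm : 1 ≤ m) (he : 1 ≤ e) :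
    ∃ A B : symPow k (sections (ℓ + e + 1) (monomialF k ℓ) n) m →ₗ[k]
        sections (ℓ + e + 1) (monomialF k ℓ) (n * m), ∀ a s r : k, s * r = 1 →
      restrictSym (ℓ + e + 1) (monomialF k ℓ) n m ∘ₗ symPowMap (twoStepMap hn he a (a * s)) m =
        twoStepMap (Nat.mul_pos hn hm) he (a ^ m) (a ^ m * s) ∘ₗ (A + r • B) := by
  -- Products of the sections `regSection` may have a nilpotent component in the basis of
  -- H⁰(ω^(nm)). That component does not acquire the factor `s`, so undoing the diagonal map of the
  -- target multiplies it by `r`; it is the map `B`.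
  refine ⟨twoStepMap (Nat.mul_pos hn hm) he 1 0 ∘ₗ restrictReg ℓ n hn he m +
    (restrictSym (ℓ + e + 1) (monomialF k ℓ) n m - restrictReg ℓ n hn he m),
    twoStepMap (Nat.mul_pos hn hm) he 0 1 ∘ₗ restrictReg ℓ n hn he m, fun a s r hsr => ?_⟩
  ext1 z
  exact (restrictSym_twoStepMap hn he m a s z).trans (twoStepMap_apply_add (Nat.mul_pos hn hm) he
    hsr _ (restrictSym_sub_restrictReg_mem hn he m z)).symm

end Ribbon

end

/-! ### The subgroup contracting the ribbon to its reduced curve, and its weight -/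

noncomputable section

namespace GIT

theorem not_isSemistable_of_forall_eq_compLinearMap {k G M W : Type*} [Field k] [CharZero k]
    [Group G] [AddCommGroup M] [Module k M] [AddCommGroup W] [Module k W] {P : ℕ}
    (ρ : Representation k G (M [⋀^Fin P]→ₗ[k] k)) {x : M [⋀^Fin P]→ₗ[k] k} {γ : kˣ → G}
    {φ : W [⋀^Fin P]→ₗ[k] k} {A B : M →ₗ[k] W} {K N : ℕ} (hK : K ≠ 0)
    (h : ∀ t : kˣ, ρ (γ t) x = (t ^ K : k) • φ.compLinearMap (A + (t ^ N : k) • B)) :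
    ¬ IsSemistable ρ x := by
  obtain ⟨p, y, hpy⟩ := exists_compLinearMap_add_smul φ A B
  refine not_isSemistable_of_forall_eq_sum _ _ γ
    (fun i => Polynomial.X ^ K * (p i).comp (Polynomial.X ^ N)) y (fun i => by simp [hK])
      fun t => ?_
  rw [h, hpy, Finset.smul_sum]
  refine Finset.sum_congr rfl fun i _ => ?_
  rw [smul_smul, Polynomial.eval_mul, Polynomial.eval_comp, Polynomial.eval_pow,
    Polynomial.eval_pow, Polynomial.eval_X]

end GIT

namespace Ribbon

open GIT

variable {k : Type u} [Field k] {ℓ e n m : ℕ}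

theorem destabilizing_weight_pos {n m d : ℤ} (hn : 2 ≤ n) (hm : 2 ≤ m) (hd : 2 ≤ d)
    (h : ¬(d = 2 ∧ n = 2 ∧ m = 2)) :
    (2 * n - 1) * (n * m * d - d - 1) < m * (2 * n * m - 1) * (n * d - d - 1) := by
  obtain ⟨x, rfl⟩ : ∃ x, n = x + 2 := ⟨n - 2, by ring⟩
  obtain ⟨y, rfl⟩ : ∃ y, m = y + 2 := ⟨m - 2, by ring⟩
  obtain ⟨z, rfl⟩ : ∃ z, d = z + 2 := ⟨d - 2, by ring⟩
  have hx : 0 ≤ x := by omega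
  have hy : 0 ≤ y := by omega
  have hz : 0 ≤ z := by omega
  -- After the shift by 2 the difference of the two sides has one negative term, the constant -1. It
  -- is outweighed unless x = y = z = 0, the excluded case.
  have h1 : 0 < 3 * y + 14 * x + 5 * z - 1 := by omega
  have h2 : 0 ≤ y * x * 24 + y * x * z * 16 + y * x ^ 2 * 12 + y * x ^ 2 * z * 6 + y * z * 9 +
      y ^ 2 * 4 + y ^ 2 * x * 10 + y ^ 2 * x * z * 6 + y ^ 2 * x ^ 2 * 4 + y ^ 2 * x ^ 2 * z * 2 +
      y ^ 2 * z * 4 + x * z * 10 + x ^ 2 * 8 + x ^ 2 * z * 4 := by positivity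
  linear_combination h1 + h2

/-- The weights of the one-parameter subgroup that contracts the ribbon to its reduced curve. -/
theorem sum_twoStep_weights (ℓ e n : ℕ) :
    ∑ i : SecIndex ℓ e n, (Sum.elim (fun _ => -((n * (ℓ + e) - (ℓ + e + 1) : ℕ) : ℤ))
      (fun _ => ((n * (ℓ + e) + 1 : ℕ) : ℤ)) i : ℤ) = 0 := by
  rw [Fintype.sum_sum_type]
  simp only [Sum.elim_inl, Sum.elim_inr, Finset.sum_const, Finset.card_univ, Fintype.card_fin,
    nsmul_eq_mul]
  ring

/-- The two total dimensions are d(2nm - 1) and d(2n - 1), so `K` is d times the gap in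
`destabilizing_weight_pos`. -/
theorem exists_destabilizing_weight {d : ℕ} (hn : 2 ≤ n) (hm : 2 ≤ m) (hd : 2 ≤ d)
    (h : ¬(d = 2 ∧ n = 2 ∧ m = 2)) :
    ∃ K, (n * d - (d + 1)) * m * (n * m * d + 1 + (n * m * d - (d + 1))) =
      (n * d + 1 + (n * d - (d + 1))) * (n * m * d - (d + 1)) + K ∧ K ≠ 0 := by
  have h1 := destabilizing_weight_pos (n := n) (m := m) (d := d) (by omega) (by omega)
    (by omega) (by omega)
  have h2 : 2 * d ≤ n * d := Nat.mul_le_mul_right _ hn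
  have h3 : n * d ≤ n * m * d :=
    Nat.mul_le_mul_right _ (Nat.le_mul_of_pos_right _ (by omega))
  have hlt : (n * d + 1 + (n * d - (d + 1))) * (n * m * d - (d + 1)) <
      (n * d - (d + 1)) * m * (n * m * d + 1 + (n * m * d - (d + 1))) := by
    have hd' : (0 : ℤ) < d := by omega
    zify [show d + 1 ≤ n * d by omega, show d + 1 ≤ n * m * d by omega]
    linear_combination mul_lt_mul_of_pos_left h1 hd'
  obtain ⟨K, hK⟩ := Nat.exists_eq_add_of_lt hlt
  exact ⟨K + 1, hK, by omega⟩

/-- The one-parameter subgroup that contracts the ribbon to its reduced curve. -/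
def twoStepSubgroup (hn : 1 ≤ n) (he : 1 ≤ e) :
    kˣ →* SpecialLinearGroup k (sections (ℓ + e + 1) (monomialF k ℓ) n) :=
  diagSubgroup (sectionBasis hn he) _ (sum_twoStep_weights ℓ e n)

theorem twoStepSubgroup_inv (hn : 1 ≤ n) (he : 1 ≤ e) (t : kˣ) {q N : ℕ}
    (hq : n * (ℓ + e) - (ℓ + e + 1) = q) (hN : n * (ℓ + e) + 1 + q = N) :
    ((twoStepSubgroup hn he t)⁻¹ :
      SpecialLinearGroup k (sections (ℓ + e + 1) (monomialF k ℓ) n)).1.toLinearMap =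
        twoStepMap hn he (t ^ q : k) (t ^ q * (t⁻¹ : kˣ) ^ N) := by
  rw [twoStepSubgroup, diagSubgroup_inv, twoStepMap]
  congr 1
  ext (i | i)
  · change ((t⁻¹ ^ (-((n * (ℓ + e) - (ℓ + e + 1) : ℕ) : ℤ)) : kˣ) : k) = t ^ q
    rw [hq, inv_zpow', neg_neg, zpow_natCast, Units.val_pow_eq_pow_val]
  · change ((t⁻¹ ^ ((n * (ℓ + e) + 1 : ℕ) : ℤ) : kˣ) : k) = t ^ q * (t⁻¹ : kˣ) ^ N
    rw [← hN, zpow_natCast, Units.val_pow_eq_pow_val, add_comm _ q, pow_add _ q, ← mul_assoc,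
      ← mul_pow, Units.mul_inv, one_pow, one_mul]

theorem exists_hilbertPoint_twoStepMap (hn : 1 ≤ n) (hm : 1 ≤ m) (he : 1 ≤ e) (b) :
    ∃ A B : symPow k (sections (ℓ + e + 1) (monomialF k ℓ) n) m →ₗ[k]
        sections (ℓ + e + 1) (monomialF k ℓ) (n * m), ∀ a s r : k, s * r = 1 →
      (hilbertPoint (ℓ + e + 1) (monomialF k ℓ) n m b).compLinearMap
          (symPowMap (twoStepMap hn he a (a * s)) m) =
        ((a ^ m) ^ (n * m * (ℓ + e) + 1) * (a ^ m * s) ^ (n * m * (ℓ + e) - (ℓ + e + 1))) •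
          b.det.compLinearMap (A + r • B) := by
  obtain ⟨A, B, h⟩ := exists_restrictSym_comp_twoStepMap (k := k) (ℓ := ℓ) hn hm he
  refine ⟨A, B, fun a s r hsr => ?_⟩
  have h1 := det_compLinearMap_comp b (twoStepMap (Nat.mul_pos hn hm) he (a ^ m) (a ^ m * s))
    (A + r • B)
  rw [← h a s r hsr, det_twoStepMap] at h1
  exact h1

/-- With a = t^q and s = t^(-N), the determinant on the target is t^(qm(D+Q) - NQ) = t^K, and the
remaining map depends on t only through r = t^N. -/
theorem exists_hilbertRep_twoStepSubgroup (hn : 1 ≤ n) (hm : 1 ≤ m) (he : 1 ≤ e) (b)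
    {q N Q D K : ℕ} (hq : n * (ℓ + e) - (ℓ + e + 1) = q) (hN : n * (ℓ + e) + 1 + q = N)
    (hQ : n * m * (ℓ + e) - (ℓ + e + 1) = Q) (hD : n * m * (ℓ + e) + 1 = D)
    (hK : q * m * (D + Q) = N * Q + K) :
    ∃ A B : symPow k (sections (ℓ + e + 1) (monomialF k ℓ) n) m →ₗ[k]
        sections (ℓ + e + 1) (monomialF k ℓ) (n * m), ∀ t : kˣ,
      hilbertRep k (sections (ℓ + e + 1) (monomialF k ℓ) n) m _ (twoStepSubgroup hn he t)
        (hilbertPoint (ℓ + e + 1) (monomialF k ℓ) n m b) =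
          (t ^ K : k) • b.det.compLinearMap (A + (t ^ N : k) • B) := by
  obtain ⟨A, B, h⟩ := exists_hilbertPoint_twoStepMap hn hm he b
  refine ⟨A, B, fun t => ?_⟩
  have hsr : ((t⁻¹ : kˣ) ^ N * t ^ N : k) = 1 := by
    rw [← mul_pow, Units.inv_mul, one_pow]
  have h2 : (((t : k) ^ q) ^ m) ^ D * (((t : k) ^ q) ^ m * (t⁻¹ : kˣ) ^ N) ^ Q = t ^ K := by
    rw [← pow_mul (t : k) q m, mul_pow, ← mul_assoc, ← pow_add, ← pow_mul, hK, add_comm _ K,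
      pow_add, pow_mul, mul_assoc, ← mul_pow, mul_comm (_ ^ N), hsr, one_pow, mul_one]
  have h3 := congrArg (fun φ => (hilbertPoint (ℓ + e + 1) (monomialF k ℓ) n m b).compLinearMap
    (symPowMap φ m)) (twoStepSubgroup_inv hn he t hq hN)
  refine h3.trans ((h (t ^ q) _ _ hsr).trans (congrArg (fun c : k => c • _) ?_))
  rw [hD, hQ, h2]

theorem not_isSemistable_hilbertPoint [CharZero k] (hn : 1 ≤ n) (hm : 1 ≤ m) (he : 1 ≤ e) (b)
    {q N Q D K : ℕ} (hq : n * (ℓ + e) - (ℓ + e + 1) = q) (hN : n * (ℓ + e) + 1 + q = N)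
    (hQ : n * m * (ℓ + e) - (ℓ + e + 1) = Q) (hD : n * m * (ℓ + e) + 1 = D)
    (hK : q * m * (D + Q) = N * Q + K) (hKpos : K ≠ 0) :
    ¬ IsSemistable (hilbertRep k (sections (ℓ + e + 1) (monomialF k ℓ) n) m _)
      (hilbertPoint (ℓ + e + 1) (monomialF k ℓ) n m b) := by
  obtain ⟨A, B, hAB⟩ := exists_hilbertRep_twoStepSubgroup hn hm he b hq hN hQ hD hK
  exact not_isSemistable_of_forall_eq_compLinearMap _ hKpos hAB

theorem hilbertUnstable_of_two_le [CharZero k] (hℓ : 1 ≤ ℓ) (he : 1 ≤ e) (hn : 2 ≤ n) (hm : 2 ≤ m)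
    (h : ¬(ℓ + e = 2 ∧ n = 2 ∧ m = 2)) :
    HilbertUnstable (ℓ + e + 1) (monomialF k ℓ) n m := by
  have hn' : 1 ≤ n := by omega
  have hm' : 1 ≤ m := by omega
  obtain ⟨K, hK, hKpos⟩ := exists_destabilizing_weight hn hm (show 2 ≤ ℓ + e by omega) h
  exact fun b => ⟨hilbertPoint_ne_zero hℓ he hn' hm' b,
    not_isSemistable_hilbertPoint hn' hm' he b rfl rfl rfl rfl hK hKpos⟩

end Ribbon

end

theorem mainTheorem3 {k : Type u} [Field k] [IsAlgClosed k] [CharZero k] (g ℓ : ℕ)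
    (hℓ : 1 ≤ ℓ) (hg : ℓ + 2 ≤ g) :
    (∃ ρ : ModObj (Ribbon.Gm k) (Ribbon.overScheme g (Ribbon.monomialF k ℓ)),
      Ribbon.IsStandardAction g ℓ ρ) ∧
    (∀ n : ℕ, 1 ≤ n →
      Module.Finite k (Ribbon.sections g (Ribbon.monomialF k ℓ) n) ∧
      Module.finrank k (Ribbon.sections g (Ribbon.monomialF k ℓ) n) =
        if n = 1 then g else (2 * n - 1) * (g - 1)) ∧
    (2 * ℓ + 1 ≠ g → ∀ n m : ℕ, 1 ≤ n → 2 ≤ m →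
      Ribbon.HilbertUnstable g (Ribbon.monomialF k ℓ) n m) ∧
    (2 * ℓ + 1 = g → ∀ n m : ℕ, 2 ≤ n → 2 ≤ m → ¬ (g = 3 ∧ n = 2 ∧ m = 2) →
      Ribbon.HilbertUnstable g (Ribbon.monomialF k ℓ) n m) ∧
    (2 * ℓ + 1 = g →
      ∃ σ : kˣ →* SpecialLinearGroup k (Ribbon.sections g (Ribbon.monomialF k ℓ) 1),
        Ribbon.IsInducedSubgroup g ℓ 1 σ ∧
        ∀ m : ℕ, 2 ≤ m → ∀ b,
          GIT.IsStrictlySemistableWrt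
            (GIT.hilbertRep k (Ribbon.sections g (Ribbon.monomialF k ℓ) 1) m _) σ
            (Ribbon.hilbertPoint g (Ribbon.monomialF k ℓ) 1 m b)) := by
  obtain ⟨e, rfl⟩ : ∃ e, g = ℓ + e + 1 := ⟨g - ℓ - 1, by omega⟩
  have he : 1 ≤ e := by omega
  refine ⟨Ribbon.exists_isStandardAction _ ℓ, fun n hn => ⟨Ribbon.finite_sections hn he,
    (Ribbon.finrank_sections hn he).trans (Ribbon.card_secIndex hn he)⟩, fun hne n m hn hm => ?_,
    fun _ n m hn hm h => Ribbon.hilbertUnstable_of_two_le hℓ he hn hm (by omega), fun h => ?_⟩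
  · obtain rfl | hn2 := hn.eq_or_lt
    · exact Ribbon.hilbertUnstable_one hℓ he (by omega) hm
    -- The exceptional case ℓ + e = 2 would force ℓ = e = 1, contrary to `hne`.
    · exact Ribbon.hilbertUnstable_of_two_le hℓ he hn2 hm (by omega)
  · obtain rfl : ℓ = e := by omega
    exact Ribbon.exists_isInducedSubgroup he
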